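/- Notation. $Q(c,\rho)\subset\mathbb R^2$ is the open axis-parallel square with centre $c$ and side length $2\rho$, $B(c,\rho)$ is the open disc, and $|\cdot|$ is the Euclidean norm on $\mathbb R^2$ and also denotes (as does $\|\cdot\|$) the operator norm of linear and bilinear maps, while $|S|$ is the area of a set $S$. A quadratic mapping is a map $\mathbb R^2\to\mathbb R^2$ both of whose coordinates are polynomials of degree at most $2$. Interpolants. Let $r>0$ and let $T$ be a closed right triangle with one horizontal and one vertical side of length $r$ and its third side in the direction $[-1,1]$. Let $a_T$ be the left end of the horizontal side, $b_T$ the upper end of the vertical side and $c_T$ the lower right end of the diagonal side; these are the three vertices of $T$. For $f\in W^{2,1}$ near $T$, the FEM-type quadratic interpolant of $f$ on $T$ is the quadratic mapping $A$ such that $$A(v)=\frac1{|B(v,\frac r{10})|}\int_{B(v,\frac r{10})}f\quad\text{for } v\in\{a_T,b_T,c_T\},$$ $$D_xA(a_T)=\frac1{|B(a_T,\frac r{10})|}\int_{B(a_T,\frac r{10})}D_xf,\qquad -D_yA(b_T)=\frac1{|B(b_T,\frac r{10})|}\int_{B(b_T,\frac r{10})}-D_yf,$$ $$(-D_x+D_y)A(c_T)=\frac1{|B(c_T,\frac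 r{10})|}\int_{B(c_T,\frac r{10})}(-D_x+D_y)f .$$ Theorem. There are absolute constants $C,C_0,C_1>0$ with the following property. Let $r>0$, $0<\delta<1$ and $\epsilon>0$. Let $T_1$ be the triangle with vertices $[0,0],[r,0],[0,r]$. Let $f\in W^{2,1}(Q(0,3r),\mathbb R^2)$ be such that $f|_{Q(0,2r)}$ is a homeomorphism onto its image, and let $Df$, $D^2f$ be everywhere defined representatives of its weak derivatives (so that $Df(0)$, $D^2f(0)$ and $J_f(0)=\det Df(0)$ make sense). Assume that $$J_f(0)>\delta,\qquad \|Df(0)\|<\frac1\delta,$$ $$|f(z)-f(0)-Df(0)z|<\epsilon|z|\quad\text{for every } z\in Q(0,3r)\setminus\{0\},$$ $$\frac1{|Q(0,3r)|}\int_{Q(0,3r)}|Df(z)-Df(0)|\,dz<\epsilon,\qquad \frac1{|Q(0,3r)|}\int_{Q(0,3r)}|D^2f(z)-D^2f(0)|\,dz<\epsilon .$$ Then the FEM-type quadratic interpolant $A_1$ of $f$ on $T_1$ exists and is unique, and for each adjacent triangle $T_2$, that is, the one with vertices $[r,0],[0,r],[r,r]$, or $[0,0],[r,0],[r,-r]$,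 or $[0,0],[0,r],[-r,r]$, the FEM-type quadratic interpolant $A_2$ of $f$ on $T_2$ exists and is unique, and (i) for $i=1,2$, $D^2A_i$ is constant and $|D^2A_i(0)-D^2f(0)|<C\epsilon$; (ii) $|DA_1(z)-DA_2(z)|<C\epsilon r$ for every $z\in T_1\cap T_2$; (iii) $A_1=A_2$ on $T_1\cap T_2$, and if $\epsilon<C_0\delta^2$, then the mapping $A$ equal to $A_1$ on $T_1$ and to $A_2$ on $T_2$ is a homeomorphism of $T_1\cup T_2$ onto its image, with $\det DA_i>\frac\delta2$ on $T_i$ for $i=1,2$; (iv) $|f(z)-A_1(z)|<C_1r\epsilon$ for every $z\in T_1$. Moreover $A_1$ does not depend on the choice of $T_2$. -/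

import Mathlib

set_option maxSynthPendingDepth 3

open MeasureTheory
open scoped ContDiff

namespace FEMQuad

/-- The plane `ℝ²` with the Euclidean norm. -/
abbrev Plane : Type := EuclideanSpace ℝ (Fin 2)

/-- The point `[x, y]`. -/
noncomputable def pt (x y : ℝ) : Plane := !₂[x, y]

/-- The open axis-parallel square `Q(c, r)` with centre `c` and side length `2 r`. -/
def sq (c : Plane) (r : ℝ) : Set Plane := {z | |z 0 - c 0| < r ∧ |z 1 - c 1| < r}

/-- `g` is (a representative of) the weak derivative of `f` on `Ω`: both functions are locally
integrable on `Ω` and, for every test function `φ ∈ C_c^∞(Ω)` and every direction `v`,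
`∫_Ω (D_v φ) f = - ∫_Ω φ (g v)`. -/
def HasWeakFDerivOn {F : Type*} [NormedAddCommGroup F] [NormedSpace ℝ F]
    (f : Plane → F) (g : Plane → Plane →L[ℝ] F) (Ω : Set Plane) : Prop :=
  LocallyIntegrableOn f Ω volume ∧ LocallyIntegrableOn g Ω volume ∧
    ∀ φ : Plane → ℝ, ContDiff ℝ ∞ φ → HasCompactSupport φ → tsupport φ ⊆ Ω →
      ∀ v : Plane, ∫ z in Ω, (fderiv ℝ φ z v) • f z = - ∫ z in Ω, φ z • g z v

/-- `f ∈ W^{2,1}(Ω, ℝ²)`, where the everywhere defined functions `Df` and `D2f` represent the weak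
derivatives of first and second order (`D2f z v u` is the derivative in the direction `v` of the
derivative of `f` in the direction `u`). -/
def IsW21 (f : Plane → Plane) (Df : Plane → Plane →L[ℝ] Plane)
    (D2f : Plane → Plane →L[ℝ] Plane →L[ℝ] Plane) (Ω : Set Plane) : Prop :=
  IntegrableOn f Ω volume ∧ IntegrableOn Df Ω volume ∧ IntegrableOn D2f Ω volume ∧
    HasWeakFDerivOn f Df Ω ∧ HasWeakFDerivOn Df D2f Ω

/-- `f` restricted to `S` is a homeomorphism of `S` onto its image `f(S)`. -/
def IsHomeoOn (f : Plane → Plane) (S : Set Plane) : Prop :=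
  Topology.IsEmbedding (S.domRestrict f)

/-- Both coordinates of `A` are polynomials of degree at most two in two variables. -/
def IsQuadraticMap (A : Plane → Plane) : Prop :=
  ∃ a₁ a₂ a₃ a₄ a₅ a₆ : Plane, ∀ z : Plane,
    A z = a₁ + z 0 • a₂ + z 1 • a₃ + (z 0) ^ 2 • a₄ + (z 0 * z 1) • a₅ + (z 1) ^ 2 • a₆

/-- A triangle of the triangulation of the plane into squares of side length `r`, each cut along
its diagonal in the direction `[-1, 1]`. Such a triangle has one horizontal, one vertical and one
diagonal side, and its vertices are the left end `left` of the horizontal side, the upper end `top`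
of the vertical side, and the lower right end `diag` of the diagonal side. -/
structure Tri where
  left : Plane
  top : Plane
  diag : Plane

/-- The closed triangle spanned by the three vertices. -/
def Tri.carrier (T : Tri) : Set Plane := convexHull ℝ {T.left, T.top, T.diag}

/-- The triangle with vertices `[0,0]`, `[r,0]`, `[0,r]`. -/
noncomputable def baseTri (r : ℝ) : Tri := ⟨pt 0 0, pt 0 r, pt r 0⟩

/-- The triangles sharing a side with `baseTri r`: the one with vertices `[r,0], [0,r], [r,r]`,
the one with vertices `[0,0], [r,0], [r,-r]`, and the one with vertices
`[0,0], [0,r], [-r,r]`. -/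
def IsAdjacentTri (r : ℝ) (T : Tri) : Prop :=
  T = ⟨pt 0 r, pt r r, pt r 0⟩ ∨
  T = ⟨pt 0 0, pt r 0, pt r (-r)⟩ ∨
  T = ⟨pt (-r) r, pt 0 r, pt 0 0⟩

/-- `A` is the FEM-type quadratic interpolant of `f` on the triangle `T` at scale `r`: it is a
quadratic mapping whose values at the vertices are the averages of `f` over discs of radius
`r / 10` around them and whose derivatives along the three sides, each taken at one end of that
side (`[1,0]` at the left end of the horizontal side, `[0,-1]` at the upper end of the vertical
side, `[-1,1]` at the lower right end of the diagonal side), are the corresponding averages of the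
weak derivative of `f`. -/
def IsFEM (f : Plane → Plane) (Df : Plane → Plane →L[ℝ] Plane) (r : ℝ) (T : Tri)
    (A : Plane → Plane) : Prop :=
  IsQuadraticMap A ∧
  A T.left = (⨍ z in Metric.ball T.left (r / 10), f z) ∧
  A T.top = (⨍ z in Metric.ball T.top (r / 10), f z) ∧
  A T.diag = (⨍ z in Metric.ball T.diag (r / 10), f z) ∧
  fderiv ℝ A T.left (pt 1 0) = (⨍ z in Metric.ball T.left (r / 10), Df z (pt 1 0)) ∧
  fderiv ℝ A T.top (pt 0 (-1)) = (⨍ z in Metric.ball T.top (r / 10), Df z (pt 0 (-1))) ∧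
  fderiv ℝ A T.diag (pt (-1) 1) = (⨍ z in Metric.ball T.diag (r / 10), Df z (pt (-1) 1))

open Classical in
/-- The mapping equal to `A` on `S` and to `B` elsewhere. -/
noncomputable def glue (S : Set Plane) (A B : Plane → Plane) : Plane → Plane :=
  fun z => if z ∈ S then A z else B z

end FEMQuad

/-! The rough mapping `f` is replaced by its disc average `F(s)`, the mean of `f` over the disc of
radius `r / 10` about `s`. On `Q(0, 2r)` the mapping `F` is twice differentiable, and its
derivatives are the disc averages of `Df` and `D2f` (`HasWeakFDerivOn.hasFDerivAt_average_ball`). A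
disc occupies a fixed fraction of `Q(0, 3r)`, so the averaged hypotheses become pointwise ones on
`Q(0, 2r)`, up to a factor 3600: `D²F` is close to `D2f 0`, `DF` to `Df 0`, and `F` to the affine
map `f 0 + Df 0 z`.

The interpolant of `f` is exactly a quadratic Hermite interpolant of `F`. Running through the
vertices of either kind of triangle in the right cyclic order, each derivative datum is taken at a
vertex in the direction of the next one. On each side a quadratic is thus fixed by two end values
and one end slope, which determines its second derivative along the three sides and, by
polarization, everywhere. This gives existence and the quantitative bound
`IsQuadraticMap.stability`, hence uniqueness.

Stability is applied to two differences. Subtracting the second Taylor polynomial of `F` shows that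
`D²A` is close to `D2f 0` and that `DA` is within a multiple of `ε r` of `DF`; as `DF` is shared by
both triangles, their gradients are close on the common side. Subtracting the affine map shows that
`A` and `DA` are close to `f 0 + Df 0 z` and `Df 0`, which gives the distance to `f` and, for small
`ε / δ ^ 2`, the determinant bound.

Adjacent triangles share all three data of their common side, so the interpolants agree there. The
glued map is a small Lipschitz perturbation of `Df 0` because the union is convex: a segment between
the triangles crosses the common part, and the two Lipschitz estimates add up along it. Since `Df 0`
expands lengths by at least `δ ^ 2 / 4`, the glued map is an embedding. -/

namespace FEMQuad

open Metric Filter Topology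

/-! ### Differentiating disc averages through smooth cutoffs of the disc -/

section Averages

variable {F : Type*} [NormedAddCommGroup F] [NormedSpace ℝ F]

/-- A smooth bump function which is `1` on the disc of radius `(1 - 1 / (n + 2)) ρ` and vanishes
outside the disc of radius `ρ`. -/
noncomputable def discBump {ρ : ℝ} (hρ : 0 < ρ) (n : ℕ) : ContDiffBump (0 : Plane) where
  rIn := ρ * (1 - 1 / ((n : ℝ) + 2))
  rOut := ρ
  rIn_pos := by
    have : 1 / ((n : ℝ) + 2) < 1 := by
      rw [div_lt_one (by positivity)]; linarith [(Nat.cast_nonneg n : (0 : ℝ) ≤ n)]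
    exact mul_pos hρ (by linarith)
  rIn_lt_rOut := by
    have : 0 < 1 / ((n : ℝ) + 2) := by positivity
    nlinarith

theorem volume_annulus (s : Plane) {a ρ : ℝ} (ha : 0 ≤ a) (haρ : a ≤ ρ) :
    volume (ball s ρ \ ball s a) = ENNReal.ofReal (ρ ^ 2 - a ^ 2) * ENNReal.ofReal Real.pi := by
  rw [measure_sdiff (ball_subset_ball haρ) measurableSet_ball.nullMeasurableSet
    measure_ball_lt_top.ne, EuclideanSpace.volume_ball_fin_two, EuclideanSpace.volume_ball_fin_two,
    ENNReal.ofReal_sub _ (by positivity), ENNReal.sub_mul (by simp),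
    ENNReal.ofReal_pow (ha.trans haρ), ENNReal.ofReal_pow ha]

theorem tendsto_volume_annulus {ρ : ℝ} (hρ : 0 < ρ) (s : Plane) :
    Tendsto (fun n : ℕ => volume (ball s ρ \ ball s (discBump hρ n).rIn)) atTop (𝓝 0) := by
  have h : ∀ n : ℕ, volume (ball s ρ \ ball s (discBump hρ n).rIn) =
      ENNReal.ofReal (ρ ^ 2 - (ρ * (1 - 1 / ((n : ℝ) + 2))) ^ 2) * ENNReal.ofReal Real.pi :=
    fun n => volume_annulus s (discBump hρ n).rIn_pos.le (discBump hρ n).rIn_lt_rOut.le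
  simp_rw [h]
  have h0 : Tendsto (fun n : ℕ => 1 / ((n : ℝ) + 2)) atTop (𝓝 0) := by
    simp_rw [one_div]
    exact tendsto_inv_atTop_zero.comp
      (tendsto_atTop_add_const_right _ _ tendsto_natCast_atTop_atTop)
  have h1 : Tendsto (fun n : ℕ => ρ ^ 2 - (ρ * (1 - 1 / ((n : ℝ) + 2))) ^ 2) atTop (𝓝 0) := by
    have := (tendsto_const_nhds (x := ρ ^ 2)).sub
      (((tendsto_const_nhds (x := (1 : ℝ))).sub h0).const_mul ρ |>.pow 2)
    simpa using this
  have h2 := ENNReal.Tendsto.mul_const (b := ENNReal.ofReal Real.pi)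
    ((ENNReal.continuous_ofReal.tendsto 0).comp h1) (Or.inr ENNReal.ofReal_ne_top)
  simpa using h2

theorem integrable_discBump_smul {h : Plane → F} (hh : Integrable h volume) {ρ : ℝ} (hρ : 0 < ρ)
    (n : ℕ) (s : Plane) : Integrable (fun t => discBump hρ n (s - t) • h t) volume := by
  refine hh.bdd_smul (C := 1) ?_ ?_
  · exact ((discBump hρ n).continuous.comp (continuous_const.sub continuous_id)).aestronglyMeasurable
  · refine ae_of_all _ fun t => ?_
    rw [Real.norm_eq_abs, abs_of_nonneg (discBump hρ n).nonneg]
    exact (discBump hρ n).le_one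

/-- The bump and the indicator of the disc differ only on a thin annulus, and there by at most 1. -/
theorem enorm_discBump_sub_le {h : Plane → F} (hh : Integrable h volume) {ρ : ℝ} (hρ : 0 < ρ)
    (n : ℕ) (s : Plane) :
    ‖(∫ t, discBump hρ n (s - t) • h t) - ∫ t in ball s ρ, h t‖ₑ ≤
      ∫⁻ t in ball s ρ \ ball s (discBump hρ n).rIn, ‖h t‖ₑ := by
  rw [← integral_indicator measurableSet_ball,
    ← integral_sub (integrable_discBump_smul hh hρ n s) (hh.indicator measurableSet_ball),
    ← lintegral_indicator (measurableSet_ball.diff measurableSet_ball)]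
  refine (enorm_integral_le_lintegral_enorm _).trans (lintegral_mono fun t => ?_)
  have hd : ∀ R, t ∈ ball s R ↔ s - t ∈ ball (0 : Plane) R := fun R => by
    rw [mem_ball, mem_ball, dist_zero_right, dist_comm, dist_eq_norm]
  by_cases h1 : t ∈ ball s ρ
  · by_cases h2 : t ∈ ball s (discBump hρ n).rIn
    · have h3 := (discBump hρ n).one_of_mem_closedBall (ball_subset_closedBall ((hd _).1 h2))
      simp [h1, h3]
    · rw [Set.indicator_of_mem h1, Set.indicator_of_mem (show t ∈ _ \ _ from ⟨h1, h2⟩)]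
      have h3 : discBump hρ n (s - t) • h t - h t = (discBump hρ n (s - t) - 1) • h t := by
        rw [sub_smul, one_smul]
      rw [h3, ← ofReal_norm, ← ofReal_norm, norm_smul]
      refine ENNReal.ofReal_le_ofReal (mul_le_of_le_one_left (norm_nonneg _) ?_)
      rw [Real.norm_eq_abs, abs_le]
      constructor <;>
        linarith [(discBump hρ n).nonneg (x := s - t), (discBump hρ n).le_one (x := s - t)]
  · have h3 : discBump hρ n (s - t) = 0 := by
      refine (discBump hρ n).zero_of_le_dist ?_
      have := (hd ρ).not.1 h1
      simpa [discBump] using this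
    simp [h1, h3]

/-- The area of the annulus does not depend on its centre and tends to zero, so absolute continuity
of the integral makes the error small for all centres at once. -/
theorem tendstoUniformly_discBump {h : Plane → F} (hh : Integrable h volume) {ρ : ℝ}
    (hρ : 0 < ρ) :
    TendstoUniformly (fun (n : ℕ) s => ∫ t, discBump hρ n (s - t) • h t)
      (fun s => ∫ t in ball s ρ, h t) atTop := by
  rw [EMetric.tendstoUniformly_iff]
  intro ε hε
  obtain ⟨δ, hδ, H⟩ := exists_pos_setLIntegral_lt_of_measure_lt
    (f := fun t => ‖h t‖ₑ) (μ := volume) hh.2.ne hε.ne'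
  filter_upwards [(tendsto_volume_annulus hρ 0).eventually_lt_const hδ] with n hn s
  rw [edist_comm, edist_eq_enorm_sub]
  refine (enorm_discBump_sub_le hh hρ n s).trans_lt (H _ ?_)
  have hlt : (discBump hρ n).rIn ≤ ρ := (discBump hρ n).rIn_lt_rOut.le
  rw [volume_annulus s (discBump hρ n).rIn_pos.le hlt]
  rwa [volume_annulus 0 (discBump hρ n).rIn_pos.le hlt] at hn

/-- A convolution is differentiated by differentiating the bump. Since the closed disc lies in `Ω`,
the function `t ↦ φ (s - t)` is an admissible test function, and the weak derivative formula moves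
the derivative onto `h`; its minus sign cancels the one from the chain rule. -/
theorem HasWeakFDerivOn.hasFDerivAt_discBump [CompleteSpace F] {h : Plane → F}
    {g : Plane → Plane →L[ℝ] F}
    {Ω : Set Plane} (hw : HasWeakFDerivOn h g Ω) (hΩ : MeasurableSet Ω)
    (hh : IntegrableOn h Ω volume) (hg : IntegrableOn g Ω volume) {ρ : ℝ} (hρ : 0 < ρ) (n : ℕ)
    {s : Plane} (hs : closedBall s ρ ⊆ Ω) :
    HasFDerivAt (fun s => ∫ t, discBump hρ n (s - t) • Ω.indicator h t)
      (∫ t, discBump hρ n (s - t) • Ω.indicator g t) s := by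
  have hhi : Integrable (Ω.indicator h) volume := (integrable_indicator_iff hΩ).2 hh
  have hgi : Integrable (Ω.indicator g) volume := (integrable_indicator_iff hΩ).2 hg
  set φ := discBump hρ n
  have hφ : ContDiff ℝ ∞ φ := φ.contDiff
  have hd := φ.hasCompactSupport.hasFDerivAt_convolution_right
    (ContinuousLinearMap.lsmul ℝ ℝ (E := F)).flip hhi.locallyIntegrable
    (hφ.of_le (by simp)) s
  have e1 : MeasureTheory.convolution (Ω.indicator h) φ
      (ContinuousLinearMap.lsmul ℝ ℝ (E := F)).flip volume =
      fun s => ∫ t, φ (s - t) • Ω.indicator h t := by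
    ext s; simp [convolution_def]
  rw [e1] at hd
  refine hd.congr_fderiv ?_
  ext1 v
  rw [convolution_precompR_apply _ hhi.locallyIntegrable (φ.hasCompactSupport.fderiv ℝ)
    (hφ.continuous_fderiv (by simp)), convolution_def,
    ContinuousLinearMap.integral_apply (integrable_discBump_smul hgi hρ n s)]
  have hdiff : ∀ t, HasFDerivAt (fun t => φ (s - t)) (-(fderiv ℝ φ (s - t))) t := fun t => by
    have h1 : HasFDerivAt φ (fderiv ℝ φ (s - t)) (s - t) :=
      (hφ.differentiable (by simp) _).hasFDerivAt
    exact (h1.comp t ((hasFDerivAt_id t).const_sub s)).congr_fderiv (by ext v; simp)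
  have hsup : tsupport (fun t => φ (s - t)) ⊆ closedBall s ρ := by
    refine closure_minimal (fun t ht => ?_) isClosed_closedBall
    rw [mem_closedBall, dist_comm, dist_eq_norm]
    by_contra hlt
    refine ht (φ.zero_of_le_dist ?_)
    rw [dist_zero_right]
    exact (not_le.1 hlt).le
  have hw3 := hw.2.2 (fun t => φ (s - t)) (hφ.comp (contDiff_const.sub contDiff_id))
    (HasCompactSupport.of_support_subset_isCompact (isCompact_closedBall s ρ)
      (subset_closure.trans hsup)) (hsup.trans hs) v
  rw [← integral_indicator hΩ, ← integral_indicator hΩ] at hw3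
  have e2 : ∀ t, Ω.indicator (fun z => φ (s - z) • g z v) t =
      (φ (s - t) • Ω.indicator g t) v := fun t => by
    by_cases ht : t ∈ Ω <;> simp [ht]
  have e3 : ∀ t, Ω.indicator (fun z => (fderiv ℝ (fun t => φ (s - t)) z v) • h z) t =
      - ((ContinuousLinearMap.lsmul ℝ ℝ (E := F)).flip (Ω.indicator h t)
        ((fderiv ℝ φ (s - t)) v)) := fun t => by
    by_cases ht : t ∈ Ω <;> simp [ht, (hdiff t).fderiv]
  simp_rw [e2, e3, integral_neg] at hw3
  exact neg_injective hw3

/-- The integral over a disc, as a function of its centre, is differentiable, and its derivative is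
the integral of the weak derivative. -/
theorem HasWeakFDerivOn.hasFDerivAt_setIntegral_ball [CompleteSpace F] {h : Plane → F}
    {g : Plane → Plane →L[ℝ] F} {Ω U : Set Plane} (hw : HasWeakFDerivOn h g Ω)
    (hΩ : MeasurableSet Ω) (hh : IntegrableOn h Ω volume) (hg : IntegrableOn g Ω volume) {ρ : ℝ}
    (hρ : 0 < ρ) (hU : IsOpen U) (hUΩ : ∀ s ∈ U, closedBall s ρ ⊆ Ω) {s : Plane} (hs : s ∈ U) :
    HasFDerivAt (fun s => ∫ t in ball s ρ, h t) (∫ t in ball s ρ, g t) s := by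
  have hhi : Integrable (Ω.indicator h) volume := (integrable_indicator_iff hΩ).2 hh
  have hgi : Integrable (Ω.indicator g) volume := (integrable_indicator_iff hΩ).2 hg
  -- The smoothed integrals converge, and their derivatives converge uniformly, so the limit is
  -- differentiable with the limiting derivative.
  have key := hasFDerivAt_of_tendstoUniformlyOn (l := atTop) hU
    ((tendstoUniformly_discBump hgi hρ).tendstoUniformlyOn (s := U))
    (fun n s hs => hw.hasFDerivAt_discBump hΩ hh hg hρ n (hUΩ s hs))
    (fun s _ => (tendstoUniformly_discBump hhi hρ).tendsto_at s) hs
  have e : ∀ {G : Type _} [NormedAddCommGroup G] [NormedSpace ℝ G] (k : Plane → G), ∀ s ∈ U,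
      ∫ t in ball s ρ, Ω.indicator k t = ∫ t in ball s ρ, k t := fun k s hs =>
    setIntegral_congr_fun measurableSet_ball fun t ht =>
      Set.indicator_of_mem (hUΩ s hs (ball_subset_closedBall ht)) k
  rw [show (∫ t in ball s ρ, Ω.indicator g t) = ∫ t in ball s ρ, g t from
    setIntegral_congr_fun measurableSet_ball fun t ht =>
      Set.indicator_of_mem (hUΩ s hs (ball_subset_closedBall ht)) g] at key
  refine key.congr_of_eventuallyEq ?_
  filter_upwards [hU.mem_nhds hs] with s hs using (e h s hs).symm

theorem measureReal_ball_fin_two (s : Plane) {ρ : ℝ} (hρ : 0 ≤ ρ) :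
    (volume : Measure Plane).real (ball s ρ) = ρ ^ 2 * Real.pi := by
  rw [Measure.real, EuclideanSpace.volume_ball_fin_two]
  simp [hρ, Real.pi_pos.le]

/-- The average over a disc, as a function of its centre, is differentiable, and its derivative is
the average of the weak derivative. -/
theorem HasWeakFDerivOn.hasFDerivAt_average_ball [CompleteSpace F] {h : Plane → F}
    {g : Plane → Plane →L[ℝ] F} {Ω U : Set Plane} (hw : HasWeakFDerivOn h g Ω)
    (hΩ : MeasurableSet Ω) (hh : IntegrableOn h Ω volume) (hg : IntegrableOn g Ω volume) {ρ : ℝ}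
    (hρ : 0 < ρ) (hU : IsOpen U) (hUΩ : ∀ s ∈ U, closedBall s ρ ⊆ Ω) {s : Plane} (hs : s ∈ U) :
    HasFDerivAt (fun s => ⨍ t in ball s ρ, h t) (⨍ t in ball s ρ, g t) s := by
  simp_rw [setAverage_eq, measureReal_ball_fin_two _ hρ.le]
  exact (hw.hasFDerivAt_setIntegral_ball hΩ hh hg hρ hU hUΩ hs).const_smul _

/-- The average of `h` over a disc contained in `Ω` differs from the constant `c` by at most the
average over `Ω` of the distance to `c`, times a bound for the ratio of the areas. -/
theorem norm_average_ball_sub_le [CompleteSpace F] {h : Plane → F} {Ω : Set Plane}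
    (hh : IntegrableOn h Ω volume) {K ρ : ℝ} (hρ : 0 < ρ) (hΩ0 : volume Ω ≠ ⊤)
    (hΩ : volume.real Ω ≤ K * volume.real (ball (0 : Plane) ρ)) {s : Plane}
    (hs : ball s ρ ⊆ Ω) (c : F) :
    ‖(⨍ t in ball s ρ, h t) - c‖ ≤ K * ⨍ t in Ω, ‖h t - c‖ := by
  have hb : 0 < volume.real (ball s ρ) := by
    rw [measureReal_ball_fin_two _ hρ.le]; positivity
  have hbΩ : volume.real (ball s ρ) ≤ volume.real Ω := measureReal_mono hs hΩ0
  have hci : IntegrableOn (fun _ : Plane => c) Ω volume := integrableOn_const hΩ0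
  have hi : IntegrableOn (fun t => h t - c) Ω volume := hh.sub hci
  have hI : 0 ≤ ∫ t in Ω, ‖h t - c‖ := integral_nonneg fun _ => norm_nonneg _
  have h1 : (⨍ t in ball s ρ, h t) - c = (volume.real (ball s ρ))⁻¹ •
      ∫ t in ball s ρ, (h t - c) := by
    rw [integral_sub (hh.mono_set hs) (hci.mono_set hs), setAverage_eq, smul_sub,
      setIntegral_const, smul_smul, inv_mul_cancel₀ hb.ne', one_smul]
  have h2 : ‖∫ t in ball s ρ, (h t - c)‖ ≤ ∫ t in Ω, ‖h t - c‖ :=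
    (norm_integral_le_integral_norm _).trans
      (setIntegral_mono_set hi.norm (ae_of_all _ fun _ => norm_nonneg _) hs.eventuallyLE)
  rw [h1, norm_smul, Real.norm_of_nonneg (by positivity), setAverage_eq, smul_eq_mul, ← mul_assoc]
  refine mul_le_mul ?_ h2 (norm_nonneg _) ?_
  · rw [← div_eq_mul_inv, le_div_iff₀ (hb.trans_le hbΩ), inv_mul_le_iff₀ hb]
    rw [measureReal_ball_fin_two _ hρ.le] at hΩ ⊢
    linarith
  · have : 0 ≤ K := by
      by_contra hK
      have : 0 < volume.real (ball (0 : Plane) ρ) := by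
        rw [measureReal_ball_fin_two _ hρ.le]; positivity
      nlinarith
    exact mul_nonneg this (inv_nonneg.2 measureReal_nonneg)

end Averages

/-! ### Quadratic mappings: Taylor form, stability and Hermite interpolation -/

section Quadratic

/-- The quadratic mapping with value `a`, derivative `m` and second derivative `B` at `p`. -/
noncomputable def quadAt (p a : Plane) (m : Plane →L[ℝ] Plane) (B : Plane →L[ℝ] Plane →L[ℝ] Plane) :
    Plane → Plane :=
  fun z => a + m (z - p) + (1 / 2 : ℝ) • B (z - p) (z - p)

@[simp] theorem pt_zero (x y : ℝ) : pt x y 0 = x := rfl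

@[simp] theorem pt_one (x y : ℝ) : pt x y 1 = y := rfl

theorem plane_ext {u v : Plane} (h0 : u 0 = v 0) (h1 : u 1 = v 1) : u = v := by
  ext i; fin_cases i
  · exact h0
  · exact h1

theorem eq_smul_pt_add (z : Plane) : z = z 0 • pt 1 0 + z 1 • pt 0 1 :=
  plane_ext (by simp) (by simp)

theorem isQuadraticMap_quadAt (p a : Plane) (m : Plane →L[ℝ] Plane)
    (B : Plane →L[ℝ] Plane →L[ℝ] Plane) : IsQuadraticMap (quadAt p a m B) := by
  refine ⟨a - m p + (1 / 2 : ℝ) • B p p,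
    m (pt 1 0) - (1 / 2 : ℝ) • (B (pt 1 0) p + B p (pt 1 0)),
    m (pt 0 1) - (1 / 2 : ℝ) • (B (pt 0 1) p + B p (pt 0 1)),
    (1 / 2 : ℝ) • B (pt 1 0) (pt 1 0), (1 / 2 : ℝ) • (B (pt 1 0) (pt 0 1) + B (pt 0 1) (pt 1 0)),
    (1 / 2 : ℝ) • B (pt 0 1) (pt 0 1), fun z => ?_⟩
  have hm : m z = z 0 • m (pt 1 0) + z 1 • m (pt 0 1) := by
    conv_lhs => rw [eq_smul_pt_add z]
    simp
  have hB1 : ∀ w, B z w = z 0 • B (pt 1 0) w + z 1 • B (pt 0 1) w := fun w => by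
    conv_lhs => rw [eq_smul_pt_add z]
    simp
  have hB2 : ∀ w, B w z = z 0 • B w (pt 1 0) + z 1 • B w (pt 0 1) := fun w => by
    conv_lhs => rw [eq_smul_pt_add z]
    simp
  simp only [quadAt, map_sub, sub_apply]
  rw [hm, hB1 z, hB1 p, hB2 p, hB2, hB2]
  module

theorem IsQuadraticMap.exists_quadAt {A : Plane → Plane} (hA : IsQuadraticMap A) (p : Plane) :
    ∃ a m B, (∀ u v, B u v = B v u) ∧ A = quadAt p a m B := by
  obtain ⟨a₁, a₂, a₃, a₄, a₅, a₆, h⟩ := hA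
  let x : Plane →L[ℝ] ℝ := EuclideanSpace.proj 0
  let y : Plane →L[ℝ] ℝ := EuclideanSpace.proj 1
  have hx : ∀ z, x z = z 0 := fun z => rfl
  have hy : ∀ z, y z = z 1 := fun z => rfl
  refine ⟨A p, x.smulRight (a₂ + (2 * p 0) • a₄ + p 1 • a₅) +
    y.smulRight (a₃ + p 0 • a₅ + (2 * p 1) • a₆),
    x.smulRight ((2 : ℝ) • x.smulRight a₄ + y.smulRight a₅) +
    y.smulRight (x.smulRight a₅ + (2 : ℝ) • y.smulRight a₆), fun u v => ?_, funext fun z => ?_⟩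
  · simp [hx, hy]
    module
  · simp [quadAt, h, hx, hy]
    module

theorem hasFDerivAt_quadAt (p a : Plane) (m : Plane →L[ℝ] Plane)
    {B : Plane →L[ℝ] Plane →L[ℝ] Plane} (hB : ∀ u v, B u v = B v u) (z : Plane) :
    HasFDerivAt (quadAt p a m B) (m + B (z - p)) z := by
  have h1 : HasFDerivAt (fun z : Plane => z - p) (ContinuousLinearMap.id ℝ Plane) z :=
    (hasFDerivAt_id z).sub_const p
  have h2 : HasFDerivAt (fun z => m (z - p)) _ z := m.hasFDerivAt.comp z h1
  have h3 : HasFDerivAt (fun z => B (z - p)) _ z := B.hasFDerivAt.comp z h1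
  have h4 := (h2.const_add a).add ((h3.clm_apply h1).const_smul (1 / 2 : ℝ))
  refine h4.congr_fderiv ?_
  ext1 v
  simp [hB v z, hB v p]
  module

theorem fderiv_quadAt (p a : Plane) (m : Plane →L[ℝ] Plane)
    {B : Plane →L[ℝ] Plane →L[ℝ] Plane} (hB : ∀ u v, B u v = B v u) (z : Plane) :
    fderiv ℝ (quadAt p a m B) z = m + B (z - p) :=
  (hasFDerivAt_quadAt p a m hB z).fderiv

theorem fderiv_fderiv_quadAt (p a : Plane) (m : Plane →L[ℝ] Plane)
    {B : Plane →L[ℝ] Plane →L[ℝ] Plane} (hB : ∀ u v, B u v = B v u) (z : Plane) :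
    fderiv ℝ (fderiv ℝ (quadAt p a m B)) z = B := by
  rw [funext (fderiv_quadAt p a m hB)]
  have h1 : HasFDerivAt (fun z : Plane => z - p) (ContinuousLinearMap.id ℝ Plane) z :=
    (hasFDerivAt_id z).sub_const p
  exact ((B.hasFDerivAt.comp z h1).const_add m).fderiv

theorem IsQuadraticMap.differentiableAt {A : Plane → Plane} (hA : IsQuadraticMap A) (z : Plane) :
    DifferentiableAt ℝ A z := by
  obtain ⟨a, m, B, hB, rfl⟩ := hA.exists_quadAt 0
  exact (hasFDerivAt_quadAt 0 a m hB z).differentiableAt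

theorem IsQuadraticMap.fderiv_fderiv_eq {A : Plane → Plane} (hA : IsQuadraticMap A) (z : Plane) :
    fderiv ℝ (fderiv ℝ A) z = fderiv ℝ (fderiv ℝ A) 0 := by
  obtain ⟨a, m, B, hB, rfl⟩ := hA.exists_quadAt 0
  rw [fderiv_fderiv_quadAt _ _ _ hB, fderiv_fderiv_quadAt _ _ _ hB]

/-- A quadratic mapping coincides with its second Taylor polynomial. -/
theorem IsQuadraticMap.eq_quadAt {A : Plane → Plane} (hA : IsQuadraticMap A) (p : Plane) :
    (∀ u v, fderiv ℝ (fderiv ℝ A) 0 u v = fderiv ℝ (fderiv ℝ A) 0 v u) ∧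
      A = quadAt p (A p) (fderiv ℝ A p) (fderiv ℝ (fderiv ℝ A) 0) := by
  obtain ⟨a, m, B, hB, rfl⟩ := hA.exists_quadAt p
  rw [fderiv_fderiv_quadAt _ _ _ hB, fderiv_quadAt _ _ _ hB]
  refine ⟨hB, ?_⟩
  simp [quadAt]

theorem IsQuadraticMap.differentiableAt_fderiv {A : Plane → Plane} (hA : IsQuadraticMap A)
    (z : Plane) : DifferentiableAt ℝ (fderiv ℝ A) z := by
  obtain ⟨a, m, B, hB, rfl⟩ := hA.exists_quadAt 0
  rw [funext (fderiv_quadAt 0 a m hB)]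
  fun_prop

theorem IsQuadraticMap.sub {A B : Plane → Plane} (hA : IsQuadraticMap A) (hB : IsQuadraticMap B) :
    IsQuadraticMap (fun z => A z - B z) := by
  obtain ⟨a₁, a₂, a₃, a₄, a₅, a₆, h⟩ := hA
  obtain ⟨b₁, b₂, b₃, b₄, b₅, b₆, h'⟩ := hB
  refine ⟨a₁ - b₁, a₂ - b₂, a₃ - b₃, a₄ - b₄, a₅ - b₅, a₆ - b₆, fun z => ?_⟩
  simp only [h, h']
  module

theorem IsQuadraticMap.fderiv_sub {A B : Plane → Plane} (hA : IsQuadraticMap A)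
    (hB : IsQuadraticMap B) (z : Plane) :
    fderiv ℝ (fun z => A z - B z) z = fderiv ℝ A z - fderiv ℝ B z :=
  _root_.fderiv_fun_sub (hA.differentiableAt z) (hB.differentiableAt z)

theorem IsQuadraticMap.fderiv_fderiv_sub {A B : Plane → Plane} (hA : IsQuadraticMap A)
    (hB : IsQuadraticMap B) (z : Plane) :
    fderiv ℝ (fderiv ℝ (fun z => A z - B z)) z =
      fderiv ℝ (fderiv ℝ A) z - fderiv ℝ (fderiv ℝ B) z := by
  rw [funext (hA.fderiv_sub hB)]
  exact _root_.fderiv_fun_sub (hA.differentiableAt_fderiv z) (hB.differentiableAt_fderiv z)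

/-- A quadratic mapping vanishing at both ends of a segment, and whose derivative along the segment
vanishes at one end, vanishes on the segment. -/
theorem IsQuadraticMap.eq_zero_of_edge {G : Plane → Plane} (hG : IsQuadraticMap G) {p e : Plane}
    {r : ℝ} (hr : r ≠ 0) (h0 : G p = 0) (h1 : G (p + r • e) = 0) (h2 : fderiv ℝ G p e = 0)
    (t : ℝ) : G (p + t • e) = 0 := by
  obtain ⟨-, hq⟩ := hG.eq_quadAt p
  rw [hq] at h1
  simp only [quadAt, h0, add_sub_cancel_left, map_smul, h2, smul_apply,
    smul_zero, zero_add, smul_eq_zero] at h1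
  have h3 : fderiv ℝ (fderiv ℝ G) 0 e e = 0 := by
    rcases h1 with h | h | h | h
    · norm_num at h
    · exact absurd h hr
    · exact absurd h hr
    · exact h
  rw [hq]
  simp [quadAt, h0, h2, h3]

/-- A basis `d, e` of the plane with dual basis `σ, τ`, with bounds for the norms. -/
structure IsFrame (d e : Plane) (σ τ : Plane →L[ℝ] ℝ) : Prop where
  eq_add : ∀ u, u = σ u • d + τ u • e
  norm_fst : ‖d‖ ≤ 2
  norm_snd : ‖e‖ ≤ 2
  norm_add : ‖d + e‖ ≤ 2
  abs_fst : ∀ u, |σ u| ≤ 2 * ‖u‖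
  abs_snd : ∀ u, |τ u| ≤ 2 * ‖u‖
  fst_fst : σ d = 1
  fst_snd : σ e = 0
  snd_fst : τ d = 0
  snd_snd : τ e = 1

/-- This is Taylor's formula along one side of a triangle: `x` and `y` are the end values, `v` the
slope at the start and `w` the second derivative along the side. Solving for `w` costs three errors
of size `η * r`. -/
theorem norm_sq_coeff_le {r η : ℝ} (hr : 0 < r) {x y v w : Plane} (hx : ‖x‖ ≤ η * r)
    (hy : ‖y‖ ≤ η * r) (hv : ‖v‖ ≤ η) (h : y = x + r • v + (r ^ 2 / 2) • w) :
    ‖w‖ ≤ 6 * (η / r) := by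
  have h1 : (r ^ 2 / 2) • w = y - x - r • v := by rw [h]; abel
  have h2 : ‖(r ^ 2 / 2) • w‖ ≤ 3 * (η * r) := by
    rw [h1]
    have h3 : ‖r • v‖ ≤ η * r := by
      rw [norm_smul, Real.norm_of_nonneg hr.le, mul_comm]
      exact mul_le_mul_of_nonneg_right hv hr.le
    linarith [norm_sub_le (y - x) (r • v), norm_sub_le y x]
  rw [norm_smul, Real.norm_of_nonneg (by positivity)] at h2
  rw [← mul_div_assoc, le_div_iff₀ hr]
  by_contra hlt
  push Not at hlt
  nlinarith

/-- Quadratic mappings with small interpolation data on a triangle are small. -/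
theorem IsQuadraticMap.stability {d e : Plane} {σ τ : Plane →L[ℝ] ℝ} (hf : IsFrame d e σ τ)
    {G : Plane → Plane} (hG : IsQuadraticMap G) {p : Plane} {r η : ℝ} (hr : 0 < r)
    (h0 : ‖G p‖ ≤ η * r) (h1 : ‖G (p + r • d)‖ ≤ η * r) (h2 : ‖G (p + r • (d + e))‖ ≤ η * r)
    (k0 : ‖fderiv ℝ G p d‖ ≤ η) (k1 : ‖fderiv ℝ G (p + r • d) e‖ ≤ η)
    (k2 : ‖fderiv ℝ G (p + r • (d + e)) (-(d + e))‖ ≤ η) :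
    ‖fderiv ℝ (fderiv ℝ G) 0‖ ≤ 300 * (η / r) ∧ ∀ z, ‖z - p‖ ≤ 2 * r →
      ‖fderiv ℝ G z‖ ≤ 300 * η ∧ ‖G z‖ ≤ 300 * (η * r) := by
  obtain ⟨hB, hq⟩ := hG.eq_quadAt p
  have hη : 0 ≤ η := (norm_nonneg _).trans k0
  have hηr : 0 ≤ η / r := by positivity
  generalize fderiv ℝ (fderiv ℝ G) 0 = B at *
  generalize hm : fderiv ℝ G p = m at *
  generalize ha : G p = a at *
  subst hq
  rw [fderiv_quadAt _ _ _ hB] at k1 k2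
  -- The second derivative is constant, so each of the three sides gives its value on one direction,
  -- starting from the vertex where the slope is prescribed.
  have b0 : ‖B d d‖ ≤ 6 * (η / r) := by
    refine norm_sq_coeff_le hr h0 h1 k0 ?_
    simp [quadAt]; module
  have b1 : ‖B e e‖ ≤ 6 * (η / r) := by
    refine norm_sq_coeff_le hr h1 h2 k1 ?_
    simp [quadAt, hB e d]; module
  have b2 : ‖B (d + e) (d + e)‖ ≤ 6 * (η / r) := by
    refine norm_sq_coeff_le hr h2 h0 k2 ?_
    simp [quadAt, hB e d]; module
  -- Polarization recovers the mixed term from the three diagonal ones.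
  have b3 : ‖B d e‖ ≤ 9 * (η / r) := by
    have h : (2 : ℝ) • B d e = B (d + e) (d + e) - B d d - B e e := by
      simp [hB e d]; module
    have h' : ‖(2 : ℝ) • B d e‖ ≤ 18 * (η / r) := by
      rw [h]
      linarith [norm_sub_le (B (d + e) (d + e) - B d d) (B e e),
        norm_sub_le (B (d + e) (d + e)) (B d d)]
    rw [norm_smul] at h'
    norm_num at h'
    linarith
  -- The slope along `e` is prescribed at `p + r • d`; it is carried back to `p` by subtracting the
  -- increment `r • B d e`.
  have c1 : ‖m e‖ ≤ 10 * η := by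
    have h : m e = (m + B (p + r • d - p)) e - r • B d e := by simp
    have h' : ‖r • B d e‖ ≤ 9 * η := by
      rw [norm_smul, Real.norm_of_nonneg hr.le]
      calc r * ‖B d e‖ ≤ r * (9 * (η / r)) := by gcongr
        _ = 9 * η := by field_simp
    rw [h]
    linarith [norm_sub_le ((m + B (p + r • d - p)) e) (r • B d e)]
  have lin : ∀ (ℓ : Plane →L[ℝ] Plane) (c c' : ℝ), ‖ℓ d‖ ≤ c → ‖ℓ e‖ ≤ c' →
      ∀ u, ‖ℓ u‖ ≤ 2 * (c + c') * ‖u‖ := fun ℓ c c' hc hc' u => by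
    have h : ℓ u = σ u • ℓ d + τ u • ℓ e := by
      conv_lhs => rw [hf.eq_add u]
      simp
    rw [h]
    refine (norm_add_le _ _).trans ?_
    rw [norm_smul, norm_smul, Real.norm_eq_abs, Real.norm_eq_abs]
    have s1 := mul_le_mul (hf.abs_fst u) hc (norm_nonneg _) (by positivity)
    have s2 := mul_le_mul (hf.abs_snd u) hc' (norm_nonneg _) (by positivity)
    linarith
  have nm : ‖m‖ ≤ 22 * η := by
    refine ContinuousLinearMap.opNorm_le_bound _ (by positivity) fun u => ?_
    refine (lin m _ _ k0 c1 u).trans_eq (by ring)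
  have nB : ‖B‖ ≤ 120 * (η / r) := by
    refine ContinuousLinearMap.opNorm_le_bound _ (by positivity) fun u => ?_
    refine ContinuousLinearMap.opNorm_le_bound _ (by positivity) fun v => ?_
    have hd := lin (B.flip d) _ _ b0 (by simpa [hB e d] using b3) u
    have he := lin (B.flip e) _ _ b3 b1 u
    refine (lin (B u) _ _ hd he v).trans_eq (by ring)
  refine ⟨nB.trans (by linarith), fun z hz => ?_⟩
  have hBz : ‖B (z - p)‖ ≤ 240 * η := by
    calc ‖B (z - p)‖ ≤ ‖B‖ * ‖z - p‖ := B.le_opNorm _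
      _ ≤ (120 * (η / r)) * (2 * r) := by gcongr
      _ = 240 * η := by field_simp; ring
  constructor
  · rw [fderiv_quadAt _ _ _ hB]
    linarith [norm_add_le m (B (z - p))]
  · have hmz : ‖m (z - p)‖ ≤ (22 * η) * (2 * r) := (m.le_opNorm _).trans (by gcongr)
    have hBzz : ‖(1 / 2 : ℝ) • B (z - p) (z - p)‖ ≤ (240 * η) * r := by
      rw [norm_smul]
      calc ‖(1 / 2 : ℝ)‖ * ‖B (z - p) (z - p)‖ ≤ ‖(1 / 2 : ℝ)‖ * ((240 * η) * (2 * r)) := by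
            gcongr
            exact ((B (z - p)).le_opNorm _).trans (by gcongr)
        _ = (240 * η) * r := by norm_num; ring
    unfold quadAt
    linarith [norm_add_le (a + m (z - p)) ((1 / 2 : ℝ) • B (z - p) (z - p)),
      norm_add_le a (m (z - p)), mul_nonneg hη hr.le]

/-- `A` is the quadratic mapping which agrees with `F` at the vertices `p`, `p + r d`,
`p + r (d + e)` of a triangle, and whose derivative at each vertex in the direction of the next one
agrees with `DF`. -/
structure IsHermite (F : Plane → Plane) (DF : Plane → Plane →L[ℝ] Plane) (r : ℝ) (p d e : Plane)
    (A : Plane → Plane) : Prop where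
  quad : IsQuadraticMap A
  val₀ : A p = F p
  val₁ : A (p + r • d) = F (p + r • d)
  val₂ : A (p + r • (d + e)) = F (p + r • (d + e))
  deriv₀ : fderiv ℝ A p d = DF p d
  deriv₁ : fderiv ℝ A (p + r • d) e = DF (p + r • d) e
  deriv₂ : fderiv ℝ A (p + r • (d + e)) (-(d + e)) = DF (p + r • (d + e)) (-(d + e))

/-- The difference of two interpolants has zero data, so stability with `η = 0` annihilates its
whole Taylor expansion. -/
theorem IsHermite.unique {F : Plane → Plane} {DF : Plane → Plane →L[ℝ] Plane} {r : ℝ}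
    {p d e : Plane} {σ τ : Plane →L[ℝ] ℝ} (hf : IsFrame d e σ τ) (hr : 0 < r)
    {A B : Plane → Plane} (hA : IsHermite F DF r p d e A) (hB : IsHermite F DF r p d e B) :
    B = A := by
  have hG := hB.quad.sub hA.quad
  obtain ⟨s1, s2⟩ := hG.stability hf (p := p) (η := 0) hr
    (by simp [hA.val₀, hB.val₀]) (by simp [hA.val₁, hB.val₁]) (by rw [hA.val₂, hB.val₂]; simp)
    (by rw [hB.quad.fderiv_sub hA.quad]; simp [hA.deriv₀, hB.deriv₀])
    (by rw [hB.quad.fderiv_sub hA.quad]; simp [hA.deriv₁, hB.deriv₁])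
    (by rw [hB.quad.fderiv_sub hA.quad, sub_apply, hA.deriv₂, hB.deriv₂]; simp)
  have h1 : fderiv ℝ (fderiv ℝ fun z => B z - A z) 0 = 0 := by simpa using s1
  obtain ⟨h2, h3⟩ := s2 p (by simp [hr.le])
  have h2' : fderiv ℝ (fun z => B z - A z) p = 0 := by simpa using h2
  have h3' : B p - A p = 0 := by simpa using h3
  have hq := (hG.eq_quadAt p).2
  rw [h1, h2', h3'] at hq
  funext z
  have := congrFun hq z
  simp only [quadAt] at this
  simpa [sub_eq_zero] using this

theorem IsHermite.exists {d e : Plane} {σ τ : Plane →L[ℝ] ℝ} (hf : IsFrame d e σ τ)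
    (F : Plane → Plane) (DF : Plane → Plane →L[ℝ] Plane) {r : ℝ} (hr : 0 < r) (p : Plane) :
    ∃ A, IsHermite F DF r p d e A := by
  obtain ⟨v0, hv0⟩ : ∃ v, v = F p := ⟨_, rfl⟩
  obtain ⟨v1, hv1⟩ : ∃ v, v = F (p + r • d) := ⟨_, rfl⟩
  obtain ⟨v2, hv2⟩ : ∃ v, v = F (p + r • (d + e)) := ⟨_, rfl⟩
  obtain ⟨w0, hw0⟩ : ∃ v, v = DF p d := ⟨_, rfl⟩
  obtain ⟨w1, hw1⟩ : ∃ v, v = DF (p + r • d) e := ⟨_, rfl⟩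
  obtain ⟨w2, hw2⟩ : ∃ v, v = DF (p + r • (d + e)) (-(d + e)) := ⟨_, rfl⟩
  -- The data along the sides force the second derivatives `n0`, `n1`, `n2` in the directions `d`,
  -- `e`, `d + e`. Polarization then forces `N` as the mixed term, and the slope at the second
  -- vertex forces the derivative at `p` along `e` to be `w1 - r • N`.
  obtain ⟨n0, hn0⟩ : ∃ n, n = (2 / r ^ 2) • (v1 - v0 - r • w0) := ⟨_, rfl⟩
  obtain ⟨n1, hn1⟩ : ∃ n, n = (2 / r ^ 2) • (v2 - v1 - r • w1) := ⟨_, rfl⟩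
  obtain ⟨n2, hn2⟩ : ∃ n, n = (2 / r ^ 2) • (v0 - v2 - r • w2) := ⟨_, rfl⟩
  obtain ⟨N, hN⟩ : ∃ n, n = (1 / 2 : ℝ) • (n2 - n0 - n1) := ⟨_, rfl⟩
  obtain ⟨m, hm⟩ : ∃ m, m = σ.smulRight w0 + τ.smulRight (w1 - r • N) := ⟨_, rfl⟩
  obtain ⟨B, hBdef⟩ : ∃ B, B = σ.smulRight (σ.smulRight n0 + τ.smulRight N) +
    τ.smulRight (σ.smulRight N + τ.smulRight n1) := ⟨_, rfl⟩
  have hB : ∀ u v, B u v = B v u := fun u v => by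
    simp [hBdef]; module
  have m1 : m d = w0 := by simp [hm, hf.fst_fst, hf.snd_fst]
  have m2 : m e = w1 - r • N := by simp [hm, hf.fst_snd, hf.snd_snd]
  have B1 : B d d = n0 := by simp [hBdef, hf.fst_fst, hf.snd_fst]
  have B2 : B d e = N := by simp [hBdef, hf.fst_fst, hf.snd_fst, hf.fst_snd, hf.snd_snd]
  have B3 : B e d = N := by simp [hBdef, hf.fst_fst, hf.snd_fst, hf.fst_snd, hf.snd_snd]
  have B4 : B e e = n1 := by simp [hBdef, hf.fst_snd, hf.snd_snd]
  refine ⟨quadAt p v0 m B, isQuadraticMap_quadAt _ _ _ _, ?_, ?_, ?_, ?_, ?_, ?_⟩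
  · simp [quadAt, hv0]
  · rw [← hv1]
    simp [quadAt, m1, B1, hn0]
    match_scalars <;> field_simp <;> ring
  · rw [← hv2]
    simp [quadAt, m1, m2, B1, B2, B3, B4, hN, hn0, hn1, hn2]
    match_scalars <;> field_simp <;> ring
  · rw [fderiv_quadAt _ _ _ hB, ← hw0]
    simp [m1]
  · rw [fderiv_quadAt _ _ _ hB, ← hw1]
    simp [m2, B2]
  · rw [fderiv_quadAt _ _ _ hB, ← hw2]
    simp [m1, m2, B1, B2, B3, B4, hN, hn0, hn1, hn2]
    match_scalars <;> field_simp <;> ring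

end Quadratic

/-! ### Comparing the interpolant with a Taylor polynomial and with an affine map -/

section Approximation

theorem norm_apply_le_two_mul {M : Plane →L[ℝ] Plane} {k : ℝ} {v : Plane} (hM : ‖M‖ ≤ k)
    (hv : ‖v‖ ≤ 2) : ‖M v‖ ≤ 2 * k := by
  have := mul_le_mul hM hv (norm_nonneg _) ((norm_nonneg _).trans hM)
  linarith [M.le_opNorm v]

theorem IsFrame.norm_neg_add {d e : Plane} {σ τ : Plane →L[ℝ] ℝ} (hf : IsFrame d e σ τ) :
    ‖-(d + e)‖ ≤ 2 := by rw [norm_neg]; exact hf.norm_add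

theorem norm_add_smul_sub_le {r : ℝ} (hr : 0 < r) (p : Plane) {v : Plane} (hv : ‖v‖ ≤ 2) :
    ‖(p + r • v) - p‖ ≤ 2 * r := by
  rw [add_sub_cancel_left, norm_smul, Real.norm_of_nonneg hr.le, mul_comm]
  exact mul_le_mul_of_nonneg_right hv hr.le

variable {F : Plane → Plane} {DF : Plane → Plane →L[ℝ] Plane}
  {D2F : Plane → Plane →L[ℝ] Plane →L[ℝ] Plane} {U : Set Plane} {p : Plane}

theorem symm_of_hasFDerivAt (hUo : IsOpen U) (hF : ∀ s ∈ U, HasFDerivAt F (DF s) s)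
    (hDF : ∀ s ∈ U, HasFDerivAt DF (D2F s) s) (hp : p ∈ U) (u v : Plane) :
    D2F p u v = D2F p v u :=
  second_derivative_symmetric_of_eventually
    (Filter.eventually_of_mem (hUo.mem_nhds hp) hF) (hDF p hp) u v

/-- Taylor's formula with a remainder controlled by the oscillation of the second derivative. -/
theorem taylor_bound (hUo : IsOpen U) (hUc : Convex ℝ U)
    (hF : ∀ s ∈ U, HasFDerivAt F (DF s) s) (hDF : ∀ s ∈ U, HasFDerivAt DF (D2F s) s) {κ r : ℝ}
    (hr : 0 < r) {H : Plane →L[ℝ] Plane →L[ℝ] Plane} (h2 : ∀ s ∈ U, ‖D2F s - H‖ ≤ κ)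
    (hp : p ∈ U) {z : Plane} (hz : z ∈ U) (hzr : ‖z - p‖ ≤ 2 * r) :
    ‖F z - quadAt p (F p) (DF p) (D2F p) z‖ ≤ 8 * κ * r * r ∧
      ‖DF z - fderiv ℝ (quadAt p (F p) (DF p) (D2F p)) z‖ ≤ 4 * κ * r := by
  have hκ : 0 ≤ κ := (norm_nonneg _).trans (h2 p hp)
  have hsym := symm_of_hasFDerivAt hUo hF hDF hp
  have hD : ∀ z ∈ U, ‖z - p‖ ≤ 2 * r → ‖DF z - (DF p + D2F p (z - p))‖ ≤ 4 * κ * r := by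
    intro z hz hzr
    -- Mean value inequality for `DF` minus its linear part: both `D2F x` and `D2F p` are within `κ`
    -- of `H`, so the derivative is at most `2 * κ`.
    have := Convex.norm_image_sub_le_of_norm_hasFDerivWithin_le (f := fun z => DF z - D2F p z)
      (f' := fun z => D2F z - D2F p) (C := 2 * κ)
      (fun x hx => ((hDF x hx).sub (D2F p).hasFDerivAt).hasFDerivWithinAt)
      (fun x hx => by
        rw [← sub_sub_sub_cancel_right _ _ H]
        linarith [norm_sub_le (D2F x - H) (D2F p - H), h2 x hx, h2 p hp]) hUc hp hz
    have e : DF z - (DF p + D2F p (z - p)) = DF z - D2F p z - (DF p - D2F p p) := by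
      rw [map_sub]; abel
    rw [e]
    exact this.trans ((mul_le_mul_of_nonneg_left hzr (by positivity)).trans_eq (by ring))
  rw [fderiv_quadAt _ _ _ hsym]
  refine ⟨?_, hD z hz hzr⟩
  -- A second application, to the Taylor remainder itself. Intersecting with the closed disc keeps
  -- the gradient bound just proved available on a convex set.
  have := Convex.norm_image_sub_le_of_norm_hasFDerivWithin_le
    (f := fun z => F z - quadAt p (F p) (DF p) (D2F p) z)
    (f' := fun z => DF z - (DF p + D2F p (z - p))) (C := 4 * κ * r)
    (s := U ∩ closedBall p (2 * r)) (x := p) (y := z)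
    (fun x hx => ((hF x hx.1).sub (hasFDerivAt_quadAt _ _ _ hsym x)).hasFDerivWithinAt)
    (fun x hx => hD x hx.1 (by simpa [dist_eq_norm] using hx.2))
    (hUc.inter (convex_closedBall _ _)) ⟨hp, by simp [hr.le]⟩
    ⟨hz, by simpa [dist_eq_norm] using hzr⟩
  have hTp : quadAt p (F p) (DF p) (D2F p) p = F p := by simp [quadAt]
  rw [hTp, sub_self, sub_zero] at this
  exact this.trans ((mul_le_mul_of_nonneg_left hzr (by positivity)).trans_eq (by ring))

variable {d e : Plane} {σ τ : Plane →L[ℝ] ℝ} {A : Plane → Plane} {κ r : ℝ}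

/-- The interpolant of a mapping whose second derivative is nearly constant. -/
theorem IsHermite.approx_taylor (hf : IsFrame d e σ τ) (hUo : IsOpen U) (hUc : Convex ℝ U)
    (hF : ∀ s ∈ U, HasFDerivAt F (DF s) s) (hDF : ∀ s ∈ U, HasFDerivAt DF (D2F s) s)
    (hr : 0 < r) {H : Plane →L[ℝ] Plane →L[ℝ] Plane} (h2 : ∀ s ∈ U, ‖D2F s - H‖ ≤ κ)
    (hA : IsHermite F DF r p d e A) (hp0 : p ∈ U) (hp1 : p + r • d ∈ U)
    (hp2 : p + r • (d + e) ∈ U) :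
    ‖fderiv ℝ (fderiv ℝ A) 0 - H‖ ≤ 2401 * κ ∧
      ∀ z ∈ U, ‖z - p‖ ≤ 2 * r → ‖fderiv ℝ A z - DF z‖ ≤ 2404 * κ * r := by
  have hsym := symm_of_hasFDerivAt hUo hF hDF hp0
  obtain ⟨T, hTq, hTD2, tay⟩ : ∃ T, IsQuadraticMap T ∧ fderiv ℝ (fderiv ℝ T) 0 = D2F p ∧
      ∀ z ∈ U, ‖z - p‖ ≤ 2 * r →
        ‖F z - T z‖ ≤ 8 * κ * r * r ∧ ‖DF z - fderiv ℝ T z‖ ≤ 4 * κ * r :=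
    ⟨_, isQuadraticMap_quadAt _ _ _ _, fderiv_fderiv_quadAt _ _ _ hsym 0,
      fun z hz hzr => taylor_bound hUo hUc hF hDF hr h2 hp0 hz hzr⟩
  have dir : ∀ z ∈ U, ‖z - p‖ ≤ 2 * r → ∀ v : Plane, ‖v‖ ≤ 2 →
      ‖DF z v - fderiv ℝ T z v‖ ≤ 8 * κ * r := fun z hz hzr v hv =>
    (norm_apply_le_two_mul (tay z hz hzr).2 hv).trans_eq (by ring)
  have f0 : ‖p - p‖ ≤ 2 * r := by simp [hr.le]
  have f1 := norm_add_smul_sub_le hr p hf.norm_fst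
  have f2 := norm_add_smul_sub_le hr p hf.norm_add
  -- With `η = 8 * κ * r` both kinds of data fit: values err by `8 * κ * r * r`, and gradients by `4
  -- * κ * r`, doubled for directions of norm at most 2.
  have st := (hA.quad.sub hTq).stability hf (p := p) (η := 8 * κ * r) hr
    (by rw [hA.val₀]; exact (tay _ hp0 f0).1) (by rw [hA.val₁]; exact (tay _ hp1 f1).1)
    (by rw [hA.val₂]; exact (tay _ hp2 f2).1)
    (by rw [hA.quad.fderiv_sub hTq, sub_apply, hA.deriv₀]; exact dir _ hp0 f0 _ hf.norm_fst)
    (by rw [hA.quad.fderiv_sub hTq, sub_apply, hA.deriv₁]; exact dir _ hp1 f1 _ hf.norm_snd)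
    (by rw [hA.quad.fderiv_sub hTq, sub_apply, hA.deriv₂]; exact dir _ hp2 f2 _ hf.norm_neg_add)
  refine ⟨?_, fun z hz hzr => ?_⟩
  · have h := st.1
    rw [hA.quad.fderiv_fderiv_sub hTq, hTD2, mul_div_cancel_right₀ _ hr.ne'] at h
    linarith [norm_sub_le_norm_sub_add_norm_sub (fderiv ℝ (fderiv ℝ A) 0) (D2F p) H, h2 p hp0]
  · have h := (st.2 z hzr).1
    rw [hA.quad.fderiv_sub hTq] at h
    have h' := (tay z hz hzr).2
    rw [norm_sub_rev] at h'
    linarith [norm_sub_le_norm_sub_add_norm_sub (fderiv ℝ A z) (fderiv ℝ T z) (DF z)]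

theorem exists_isQuadraticMap_affine (c : Plane) (L : Plane →L[ℝ] Plane) :
    ∃ S : Plane → Plane, IsQuadraticMap S ∧ (∀ z, S z = c + L z) ∧ ∀ z, fderiv ℝ S z = L := by
  have hS : ∀ z, quadAt 0 c L 0 z = c + L z := fun z => by
    rw [quadAt, sub_zero, zero_apply, zero_apply, smul_zero, add_zero]
  refine ⟨quadAt 0 c L 0, isQuadraticMap_quadAt _ _ _ _, hS, fun z => ?_⟩
  rw [funext hS]
  exact (L.hasFDerivAt.const_add c).fderiv

/-- The interpolant of a nearly affine mapping. -/
theorem IsHermite.approx_affine (hf : IsFrame d e σ τ) (hr : 0 < r) {c : Plane}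
    {L : Plane →L[ℝ] Plane} (h1 : ∀ s ∈ U, ‖DF s - L‖ ≤ κ)
    (h0 : ∀ s ∈ U, ‖F s - (c + L s)‖ ≤ κ * r) (hA : IsHermite F DF r p d e A) (hp0 : p ∈ U)
    (hp1 : p + r • d ∈ U) (hp2 : p + r • (d + e) ∈ U) {z : Plane} (hzr : ‖z - p‖ ≤ 2 * r) :
    ‖fderiv ℝ A z - L‖ ≤ 600 * κ ∧ ‖A z - (c + L z)‖ ≤ 600 * κ * r := by
  have hκ : 0 ≤ κ := (norm_nonneg _).trans (h1 p hp0)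
  obtain ⟨S, hSq, hSv, hSd⟩ := exists_isQuadraticMap_affine c L
  have val : ∀ z ∈ U, ‖F z - S z‖ ≤ 2 * κ * r := fun z hz => by
    rw [hSv]; linarith [h0 z hz, mul_nonneg hκ hr.le]
  have dir : ∀ z ∈ U, ∀ v : Plane, ‖v‖ ≤ 2 → ‖DF z v - L v‖ ≤ 2 * κ := fun z hz v hv => by
    have h := norm_apply_le_two_mul (h1 z hz) hv
    rwa [sub_apply] at h
  have st := (hA.quad.sub hSq).stability hf (p := p) (η := 2 * κ) hr
    (by rw [hA.val₀]; exact val _ hp0) (by rw [hA.val₁]; exact val _ hp1)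
    (by rw [hA.val₂]; exact val _ hp2)
    (by rw [hA.quad.fderiv_sub hSq, sub_apply, hA.deriv₀, hSd]; exact dir _ hp0 _ hf.norm_fst)
    (by rw [hA.quad.fderiv_sub hSq, sub_apply, hA.deriv₁, hSd]; exact dir _ hp1 _ hf.norm_snd)
    (by rw [hA.quad.fderiv_sub hSq, sub_apply, hA.deriv₂, hSd]
        exact dir _ hp2 _ hf.norm_neg_add)
  have h := st.2 z hzr
  rw [hA.quad.fderiv_sub hSq, hSd, hSv] at h
  exact ⟨by linarith [h.1], by linarith [h.2]⟩

end Approximation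

/-! ### Squares, the two frames, and triangles as intersections of half-planes -/

section Geometry

theorem isOpen_sq (c : Plane) (r : ℝ) : IsOpen (sq c r) := by
  have h : ∀ i : Fin 2, Continuous fun z : Plane => z i := fun i =>
    (EuclideanSpace.proj (𝕜 := ℝ) i).continuous
  exact (isOpen_lt ((h 0).sub continuous_const).abs continuous_const).inter
    (isOpen_lt ((h 1).sub continuous_const).abs continuous_const)

theorem convex_sq (c : Plane) (r : ℝ) : Convex ℝ (sq c r) := by
  intro x hx y hy a b ha hb hab
  have key : ∀ i : Fin 2, |x i - c i| < r → |y i - c i| < r →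
      |(a • x + b • y) i - c i| < r := fun i h h' => by
    have := (convex_ball (c i) r) (x := x i) (by simpa [Real.dist_eq] using h) (y := y i)
      (by simpa [Real.dist_eq] using h') ha hb hab
    simpa [Real.dist_eq] using this
  exact ⟨key 0 hx.1 hy.1, key 1 hx.2 hy.2⟩

theorem abs_apply_le_norm (z : Plane) (i : Fin 2) : |z i| ≤ ‖z‖ :=
  PiLp.norm_apply_le z i

theorem norm_le_abs_add_abs (z : Plane) : ‖z‖ ≤ |z 0| + |z 1| := by
  rw [EuclideanSpace.norm_eq, Fin.sum_univ_two, Real.norm_eq_abs, Real.norm_eq_abs]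
  refine Real.sqrt_le_iff.2 ⟨by positivity, ?_⟩
  nlinarith [abs_nonneg (z 0), abs_nonneg (z 1)]

theorem norm_lt_of_mem_sq {z : Plane} {r : ℝ} (hz : z ∈ sq 0 r) : ‖z‖ < 2 * r := by
  have h0 : |z 0| < r := by simpa using hz.1
  have h1 : |z 1| < r := by simpa using hz.2
  linarith [norm_le_abs_add_abs z]

theorem closedBall_subset_sq {s : Plane} {R ρ R' : ℝ} (hs : s ∈ sq 0 R) (h : R + ρ ≤ R') :
    closedBall s ρ ⊆ sq 0 R' := by
  intro z hz
  rw [mem_closedBall, dist_eq_norm] at hz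
  have key : ∀ i : Fin 2, |s i| < R → |z i| < R' := fun i hi => by
    have h1 : |z i - s i| ≤ ‖z - s‖ := by simpa using abs_apply_le_norm (z - s) i
    linarith [abs_sub_abs_le_abs_sub (z i) (s i)]
  have h0 : |s 0| < R := by simpa using hs.1
  have h1 : |s 1| < R := by simpa using hs.2
  exact ⟨by simpa using key 0 h0, by simpa using key 1 h1⟩

/-- The first coordinate function of the plane. -/
noncomputable def xCoord : Plane →L[ℝ] ℝ := EuclideanSpace.proj 0

/-- The second coordinate function of the plane. -/
noncomputable def yCoord : Plane →L[ℝ] ℝ := EuclideanSpace.proj 1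

@[simp] theorem xCoord_apply (z : Plane) : xCoord z = z 0 := rfl

@[simp] theorem yCoord_apply (z : Plane) : yCoord z = z 1 := rfl

theorem norm_pt_le {x y : ℝ} (h : x ^ 2 + y ^ 2 ≤ 4) : ‖pt x y‖ ≤ 2 := by
  rw [EuclideanSpace.norm_eq, Fin.sum_univ_two]
  refine Real.sqrt_le_iff.2 ⟨by norm_num, ?_⟩
  simpa [sq_abs] using (by linarith : x ^ 2 + y ^ 2 ≤ 2 ^ 2)

theorem pt_add (a b c d : ℝ) : pt a b + pt c d = pt (a + c) (b + d) :=
  plane_ext (by simp) (by simp)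

theorem smul_pt (k a b : ℝ) : k • pt a b = pt (k * a) (k * b) :=
  plane_ext (by simp) (by simp)

theorem neg_pt (a b : ℝ) : -pt a b = pt (-a) (-b) :=
  plane_ext (by simp) (by simp)

/-- The frame of the triangles with the right angle at the lower left. -/
theorem isFrame_lower : IsFrame (pt 1 0) (pt (-1) 1) (xCoord + yCoord) yCoord where
  eq_add u := plane_ext (by simp) (by simp)
  norm_fst := norm_pt_le (by norm_num)
  norm_snd := norm_pt_le (by norm_num)
  norm_add := by rw [pt_add]; exact norm_pt_le (by norm_num)
  abs_fst u := by
    have := abs_add_le (u 0) (u 1)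
    simp only [add_apply, xCoord_apply, yCoord_apply]
    linarith [abs_apply_le_norm u 0, abs_apply_le_norm u 1]
  abs_snd u := by
    simp only [yCoord_apply]
    linarith [abs_apply_le_norm u 1, norm_nonneg u]
  fst_fst := by simp
  fst_snd := by simp
  snd_fst := by simp
  snd_snd := by simp

/-- The frame of the triangles with the right angle at the upper right. -/
theorem isFrame_upper : IsFrame (pt 1 0) (pt 0 (-1)) xCoord (-yCoord) where
  eq_add u := plane_ext (by simp) (by simp)
  norm_fst := norm_pt_le (by norm_num)
  norm_snd := norm_pt_le (by norm_num)
  norm_add := by rw [pt_add]; exact norm_pt_le (by norm_num)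
  abs_fst u := by
    simp only [xCoord_apply]
    linarith [abs_apply_le_norm u 0, norm_nonneg u]
  abs_snd u := by
    simp only [neg_apply, yCoord_apply, abs_neg]
    linarith [abs_apply_le_norm u 1, norm_nonneg u]
  fst_fst := by simp
  fst_snd := by simp
  snd_fst := by simp
  snd_snd := by simp

theorem IsFrame.convexHull_eq {d e : Plane} {σ τ : Plane →L[ℝ] ℝ} (hf : IsFrame d e σ τ) {r : ℝ}
    (hr : 0 < r) (p : Plane) : convexHull ℝ {p, p + r • d, p + r • (d + e)} =
      {z | 0 ≤ τ (z - p) ∧ τ (z - p) ≤ σ (z - p) ∧ σ (z - p) ≤ r} := by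
  refine Set.Subset.antisymm (convexHull_min ?_ ?_) fun z hz => ?_
  · rintro z (rfl | rfl | rfl) <;>
      simp only [Set.mem_ofPred_eq, sub_self, add_sub_cancel_left, map_zero, map_smul, map_add,
        hf.fst_fst, hf.fst_snd, hf.snd_fst, hf.snd_snd, smul_eq_mul] <;>
      norm_num [hr.le]
  · intro x hx y hy a b ha hb hab
    have key : ∀ ℓ : Plane →L[ℝ] ℝ,
        ℓ (a • x + b • y - p) = a * ℓ (x - p) + b * ℓ (y - p) := fun ℓ => by
      have : a • x + b • y - p = a • (x - p) + b • (y - p) := by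
        have h : p = (a + b) • p := by rw [hab, one_smul]
        conv_lhs => rw [h]
        module
      rw [this]
      simp only [map_add, map_smul, smul_eq_mul]
    obtain ⟨x1, x2, x3⟩ := hx
    obtain ⟨y1, y2, y3⟩ := hy
    simp only [Set.mem_ofPred_eq, key]
    refine ⟨by positivity, by gcongr, ?_⟩
    calc a * σ (x - p) + b * σ (y - p) ≤ a * r + b * r := by gcongr
      _ = r := by rw [← add_mul, hab, one_mul]
  · obtain ⟨h1, h2, h3⟩ := hz
    set s := σ (z - p)
    set t := τ (z - p)
    have hz : z = p + s • d + t • e := by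
      rw [add_assoc, ← hf.eq_add (z - p)]; abel
    -- For `z = p + s • d + t • e` the barycentric coordinates are `1 - s / r`, `(s - t) / r` and `t
    -- / r`; the three inequalities say that they are nonnegative.
    have h := (convex_convexHull ℝ {p, p + r • d, p + r • (d + e)}).sum_mem
      (t := Finset.univ) (w := ![1 - s / r, (s - t) / r, t / r])
      (z := ![p, p + r • d, p + r • (d + e)])
      (fun i _ => by
        fin_cases i
        · simpa using (div_le_one hr).2 h3
        · simpa using div_nonneg (sub_nonneg.2 h2) hr.le
        · simpa using div_nonneg h1 hr.le)
      (by simp [Fin.sum_univ_three]; ring)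
      (fun i _ => subset_convexHull ℝ _ (by fin_cases i <;> simp))
    convert h using 1
    simp only [Fin.sum_univ_three, Matrix.cons_val_zero, Matrix.cons_val_one, Matrix.cons_val]
    rw [hz]
    match_scalars <;> field_simp <;> ring

theorem mem_lower_iff {r : ℝ} (hr : 0 < r) (z : Plane) :
    z ∈ (baseTri r).carrier ↔ 0 ≤ z 0 ∧ 0 ≤ z 1 ∧ z 0 + z 1 ≤ r := by
  have h : (baseTri r).carrier = convexHull ℝ {pt 0 0, pt 0 0 + r • pt 1 0,
      pt 0 0 + r • (pt 1 0 + pt (-1) 1)} := by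
    simp only [Tri.carrier, baseTri, pt_add, smul_pt]
    rw [Set.pair_comm]
    norm_num
  rw [h, isFrame_lower.convexHull_eq hr]
  simp only [Set.mem_ofPred_eq, add_apply, xCoord_apply, yCoord_apply, PiLp.sub_apply, pt_zero,
    pt_one, sub_zero]
  constructor <;> rintro ⟨h1, h2, h3⟩ <;> refine ⟨?_, ?_, ?_⟩ <;> linarith

/-- The triangle with the right angle at the upper right and left vertex `[a, b]`. -/
noncomputable def upperTri (r a b : ℝ) : Tri := ⟨pt a b, pt (a + r) b, pt (a + r) (b - r)⟩

theorem mem_upper_iff {r : ℝ} (hr : 0 < r) (a b : ℝ) (z : Plane) :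
    z ∈ (upperTri r a b).carrier ↔ z 0 ≤ a + r ∧ z 1 ≤ b ∧ a + b ≤ z 0 + z 1 := by
  have h : (upperTri r a b).carrier = convexHull ℝ {pt a b, pt a b + r • pt 1 0,
      pt a b + r • (pt 1 0 + pt 0 (-1))} := by
    simp only [Tri.carrier, upperTri, pt_add, smul_pt]
    norm_num [sub_eq_add_neg]
  rw [h, isFrame_upper.convexHull_eq hr]
  simp only [Set.mem_ofPred_eq, neg_apply, xCoord_apply, yCoord_apply, PiLp.sub_apply, pt_zero,
    pt_one]
  constructor <;> rintro ⟨h1, h2, h3⟩ <;> refine ⟨?_, ?_, ?_⟩ <;> linarith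

theorem isClosed_carrier (T : Tri) : IsClosed T.carrier :=
  ((Set.toFinite {T.left, T.top, T.diag}).isCompact_convexHull ℝ).isClosed

theorem convex_carrier (T : Tri) : Convex ℝ T.carrier := convex_convexHull ℝ _

end Geometry

/-! ### Gluing Lipschitz bounds, perturbing invertible linear maps, determinants -/

section Homeomorphism

/-- Lipschitz bounds on two closed sets with convex union pass to the union. -/
theorem norm_glue_sub_le {S T : Set Plane} (hS : IsClosed S) (hT : IsClosed T)
    (hST : Convex ℝ (S ∪ T)) {A B : Plane → Plane} (hAB : ∀ z ∈ S ∩ T, A z = B z)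
    {L : Plane →L[ℝ] Plane} {k : ℝ}
    (hA : ∀ x ∈ S, ∀ y ∈ S, ‖(A x - L x) - (A y - L y)‖ ≤ k * ‖x - y‖)
    (hB : ∀ x ∈ T, ∀ y ∈ T, ‖(B x - L x) - (B y - L y)‖ ≤ k * ‖x - y‖) {x y : Plane}
    (hx : x ∈ S ∪ T) (hy : y ∈ S ∪ T) :
    ‖(glue S A B x - L x) - (glue S A B y - L y)‖ ≤ k * ‖x - y‖ := by
  have gS : ∀ z ∈ S, glue S A B z = A z := fun z hz => by simp [glue, hz]
  have gT : ∀ z ∈ T, glue S A B z = B z := fun z hz => by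
    by_cases h : z ∈ S
    · rw [gS z h, hAB z ⟨h, hz⟩]
    · simp [glue, h]
  have mixed : ∀ x ∈ S, ∀ y ∈ T,
      ‖(glue S A B x - L x) - (glue S A B y - L y)‖ ≤ k * ‖x - y‖ := by
    intro x hx y hy
    -- The segment stays in the convex union and is connected, so it cannot be split by two closed
    -- sets: it contains a point `w` of both. Distances add along the segment, so the two bounds sum
    -- to the required one.
    obtain ⟨w, hw, hwS, hwT⟩ := isPreconnected_closed_iff.1 (convex_segment x y).isPreconnected
      S T hS hT (hST.segment_subset (Or.inl hx) (Or.inr hy)) ⟨x, left_mem_segment ℝ x y, hx⟩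
      ⟨y, right_mem_segment ℝ x y, hy⟩
    have h1 := hA x hx w hwS
    have h2 := hB w hwT y hy
    have h3 : ‖x - w‖ + ‖w - y‖ = ‖x - y‖ := by
      simpa [dist_eq_norm] using dist_add_dist_of_mem_segment hw
    rw [gS x hx, gT y hy, ← h3, mul_add]
    rw [← hAB w ⟨hwS, hwT⟩] at h2
    exact (norm_sub_le_norm_sub_add_norm_sub _ (A w - L w) _).trans (add_le_add h1 h2)
  rcases hx with hx | hx <;> rcases hy with hy | hy
  · rw [gS x hx, gS y hy]; exact hA x hx y hy
  · exact mixed x hx y hy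
  · rw [norm_sub_rev, norm_sub_rev x]; exact mixed y hy x hx
  · rw [gT x hx, gT y hy]; exact hB x hx y hy

/-- A small Lipschitz perturbation of an injective linear mapping is a homeomorphism onto its
image. -/
theorem isHomeoOn_of_norm_sub_le {g : Plane → Plane} {S : Set Plane} {L : Plane →L[ℝ] Plane}
    {k m : ℝ} (hk : 0 ≤ k) (hkm : k < m) (hL : ∀ v, m * ‖v‖ ≤ ‖L v‖)
    (hg : ∀ x ∈ S, ∀ y ∈ S, ‖(g x - L x) - (g y - L y)‖ ≤ k * ‖x - y‖) : IsHomeoOn g S := by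
  have hlip : LipschitzWith (Real.toNNReal (k + ‖L‖)) (S.domRestrict g) := by
    refine LipschitzWith.of_dist_le_mul fun x y => ?_
    rw [Real.coe_toNNReal _ (by positivity), Subtype.dist_eq, dist_eq_norm, dist_eq_norm]
    have h1 := hg x x.2 y y.2
    have h2 := L.le_opNorm ((x : Plane) - y)
    have h3 : g x - g y = ((g x - L x) - (g y - L y)) + L (x - y) := by rw [map_sub]; abel
    change ‖g x - g y‖ ≤ _
    rw [h3]
    linarith [norm_add_le ((g x - L x) - (g y - L y)) (L ((x : Plane) - y))]
  -- The linear part expands by at least `m` and the perturbation loses at most `k`, so `g` expands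
  -- by at least `m - k`.
  have hanti : AntilipschitzWith (Real.toNNReal (m - k)⁻¹) (S.domRestrict g) := by
    refine AntilipschitzWith.of_le_mul_dist fun x y => ?_
    rw [Real.coe_toNNReal _ (inv_nonneg.2 (sub_nonneg.2 hkm.le)), Subtype.dist_eq, dist_eq_norm,
      dist_eq_norm, ← div_eq_inv_mul, le_div_iff₀ (sub_pos.2 hkm)]
    have h1 := hg x x.2 y y.2
    have h2 := hL ((x : Plane) - y)
    have h3 : L (x - y) = (g x - g y) - ((g x - L x) - (g y - L y)) := by rw [map_sub]; abel
    change _ ≤ ‖g x - g y‖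
    rw [h3] at h2
    linarith [norm_sub_le (g x - g y) ((g x - L x) - (g y - L y))]
  exact (hanti.isUniformEmbedding hlip.uniformContinuous).isEmbedding

theorem IsQuadraticMap.norm_sub_le_of_fderiv {A : Plane → Plane} (hA : IsQuadraticMap A)
    {S : Set Plane} (hS : Convex ℝ S) {L : Plane →L[ℝ] Plane} {k : ℝ}
    (h : ∀ z ∈ S, ‖fderiv ℝ A z - L‖ ≤ k) :
    ∀ x ∈ S, ∀ y ∈ S, ‖(A x - L x) - (A y - L y)‖ ≤ k * ‖x - y‖ := fun _ hx _ hy =>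
  Convex.norm_image_sub_le_of_norm_hasFDerivWithin_le (f := fun z => A z - L z)
    (f' := fun z => fderiv ℝ A z - L)
    (fun x _ => ((hA.differentiableAt x).hasFDerivAt.sub L.hasFDerivAt).hasFDerivWithinAt)
    h hS hy hx

theorem det_eq (M : Plane →L[ℝ] Plane) :
    M.det = M (pt 1 0) 0 * M (pt 0 1) 1 - M (pt 0 1) 0 * M (pt 1 0) 1 := by
  have h0 : EuclideanSpace.single (0 : Fin 2) (1 : ℝ) = pt 1 0 :=
    plane_ext (by simp) (by simp)
  have h1 : EuclideanSpace.single (1 : Fin 2) (1 : ℝ) = pt 0 1 :=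
    plane_ext (by simp) (by simp)
  rw [ContinuousLinearMap.det,
    ← LinearMap.det_toMatrix (EuclideanSpace.basisFun (Fin 2) ℝ).toBasis, Matrix.det_fin_two]
  simp [LinearMap.toMatrix_apply, h0, h1]

theorem norm_pt_one_zero : ‖pt 1 0‖ = 1 := by
  simp [EuclideanSpace.norm_eq]

theorem norm_pt_zero_one : ‖pt 0 1‖ = 1 := by
  simp [EuclideanSpace.norm_eq]

theorem abs_entry_le (M : Plane →L[ℝ] Plane) (i : Fin 2) :
    |M (pt 1 0) i| ≤ ‖M‖ ∧ |M (pt 0 1) i| ≤ ‖M‖ := by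
  have h0 := M.le_opNorm (pt 1 0)
  have h1 := M.le_opNorm (pt 0 1)
  rw [norm_pt_one_zero, mul_one] at h0
  rw [norm_pt_zero_one, mul_one] at h1
  exact ⟨(abs_apply_le_norm _ i).trans h0, (abs_apply_le_norm _ i).trans h1⟩

/-- By Cramer's rule, `det L` times a coordinate of `v` is a combination of the coordinates of `L v`
with entries of `L` as coefficients. The determinant exceeds `δ` and the entries are at most `1 /
δ`, which gives the factor `δ ^ 2`. -/
theorem sq_div_four_mul_norm_le {L : Plane →L[ℝ] Plane} {δ : ℝ} (hδ : 0 < δ) (hdet : δ < L.det)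
    (hL : ‖L‖ < 1 / δ) (v : Plane) : δ ^ 2 / 4 * ‖v‖ ≤ ‖L v‖ := by
  have hLδ : ‖L‖ * δ ≤ 1 := ((lt_div_iff₀ hδ).1 hL).le
  have hv : L v = v 0 • L (pt 1 0) + v 1 • L (pt 0 1) := by
    conv_lhs => rw [eq_smul_pt_add v]
    simp
  have e0 : L v 0 = v 0 * L (pt 1 0) 0 + v 1 * L (pt 0 1) 0 := by rw [hv]; simp
  have e1 : L v 1 = v 0 * L (pt 1 0) 1 + v 1 * L (pt 0 1) 1 := by rw [hv]; simp
  have bound : ∀ a b t : ℝ, |a| ≤ ‖L‖ → |b| ≤ ‖L‖ → L.det * t = a * L v 0 + b * L v 1 →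
      δ ^ 2 * |t| ≤ 2 * ‖L v‖ := by
    intro a b t ha hb h
    have h1 : L.det * |t| ≤ ‖L‖ * (2 * ‖L v‖) := by
      rw [← abs_of_pos (hδ.trans hdet), ← abs_mul, h]
      have m0 := mul_le_mul ha (abs_apply_le_norm (L v) 0) (abs_nonneg _) (norm_nonneg _)
      have m1 := mul_le_mul hb (abs_apply_le_norm (L v) 1) (abs_nonneg _) (norm_nonneg _)
      rw [← abs_mul] at m0 m1
      linarith [abs_add_le (a * L v 0) (b * L v 1)]
    have h2 := mul_le_mul_of_nonneg_right hdet.le (abs_nonneg t)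
    have h3 := mul_le_mul_of_nonneg_left (h2.trans h1) hδ.le
    have h4 := mul_le_mul_of_nonneg_right hLδ (by positivity : 0 ≤ 2 * ‖L v‖)
    linarith
  have b0 := bound (L (pt 0 1) 1) (-(L (pt 0 1) 0)) (v 0) (abs_entry_le L 1).2
    (by rw [abs_neg]; exact (abs_entry_le L 0).2) (by rw [det_eq, e0, e1]; ring)
  have b1 := bound (-(L (pt 1 0) 1)) (L (pt 1 0) 0) (v 1)
    (by rw [abs_neg]; exact (abs_entry_le L 1).1) (abs_entry_le L 0).1
    (by rw [det_eq, e0, e1]; ring)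
  have := mul_le_mul_of_nonneg_left (norm_le_abs_add_abs v) (by positivity : 0 ≤ δ ^ 2)
  linarith

/-- Each of the two products in the determinant moves by at most `δ / 5`, since the entries of `L`
are at most `1 / δ` and each entry moves by at most `δ ^ 2 / 16`. The total `2 * δ / 5` is less than
`δ / 2`. -/
theorem half_lt_det {L M : Plane →L[ℝ] Plane} {δ : ℝ} (hδ : 0 < δ) (hδ1 : δ < 1)
    (hdet : δ < L.det) (hL : ‖L‖ < 1 / δ) (h : ‖M - L‖ ≤ δ ^ 2 / 16) : δ / 2 < M.det := by
  have hLδ : δ * ‖L‖ ≤ 1 := by rw [mul_comm]; exact ((lt_div_iff₀ hδ).1 hL).le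
  have hM : ‖M‖ ≤ ‖L‖ + δ ^ 2 / 16 := by
    have := norm_add_le L (M - L)
    rw [add_sub_cancel] at this
    linarith
  have prod : ∀ a b a' b' : ℝ, |a' - a| ≤ δ ^ 2 / 16 → |b' - b| ≤ δ ^ 2 / 16 → |a| ≤ ‖L‖ →
      |b'| ≤ ‖M‖ → |a' * b' - a * b| ≤ δ / 5 := by
    intro a b a' b' h1 h2 h3 h4
    have e : a' * b' - a * b = (a' - a) * b' + a * (b' - b) := by ring
    have m1 := mul_le_mul h1 (h4.trans hM) (abs_nonneg _) (by positivity)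
    have m2 := mul_le_mul h3 h2 (abs_nonneg _) (norm_nonneg _)
    rw [← abs_mul] at m1 m2
    rw [e]
    refine (abs_add_le _ _).trans ?_
    have m3 := mul_le_mul_of_nonneg_left hLδ hδ.le
    have m4 : δ ^ 2 * δ ^ 2 ≤ δ := by
      have : δ ^ 3 ≤ 1 := pow_le_one₀ hδ.le hδ1.le
      nlinarith
    linarith
  have ent : ∀ i, |M (pt 1 0) i - L (pt 1 0) i| ≤ δ ^ 2 / 16 ∧
      |M (pt 0 1) i - L (pt 0 1) i| ≤ δ ^ 2 / 16 := fun i => by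
    have := abs_entry_le (M - L) i
    exact ⟨this.1.trans h, this.2.trans h⟩
  have p1 := abs_le.1 (prod _ _ _ _ (ent 0).1 (ent 1).2 (abs_entry_le L 0).1 (abs_entry_le M 1).2)
  have p2 := abs_le.1 (prod _ _ _ _ (ent 0).2 (ent 1).1 (abs_entry_le L 0).2 (abs_entry_le M 1).1)
  rw [det_eq] at hdet ⊢
  linarith [p1.1, p2.2]

end Homeomorphism

/-! ### The FEM interpolant of `f` as a Hermite interpolant of its disc averages -/

section Interpolation

theorem average_clm_apply {g : Plane → Plane →L[ℝ] Plane} {s : Set Plane}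
    (hg : IntegrableOn g s volume) (v : Plane) : (⨍ z in s, g z v) = (⨍ z in s, g z) v := by
  rw [setAverage_eq, setAverage_eq, ← ContinuousLinearMap.integral_apply hg, smul_apply]

/-- The cyclic order here is `left`, `diag`, `top`: the prescribed directions `[1,0]`, `[-1,1]`,
`[0,-1]` then point from each vertex to the next. -/
theorem isFEM_lower_iff {f : Plane → Plane} {Df : Plane → Plane →L[ℝ] Plane} {r : ℝ}
    (h0 : IntegrableOn Df (ball (pt 0 0) (r / 10)) volume)
    (h1 : IntegrableOn Df (ball (pt r 0) (r / 10)) volume)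
    (h2 : IntegrableOn Df (ball (pt 0 r) (r / 10)) volume) (A : Plane → Plane) :
    IsFEM f Df r (baseTri r) A ↔ IsHermite (fun s => ⨍ z in ball s (r / 10), f z)
      (fun s => ⨍ z in ball s (r / 10), Df z) r (pt 0 0) (pt 1 0) (pt (-1) 1) A := by
  have e1 : pt 0 0 + r • pt 1 0 = pt r 0 := by rw [smul_pt, pt_add]; norm_num
  have e2 : pt 0 0 + r • (pt 1 0 + pt (-1) 1) = pt 0 r := by
    rw [pt_add, smul_pt, pt_add]; norm_num
  have e3 : -(pt 1 0 + pt (-1) 1) = pt 0 (-1) := by rw [pt_add, neg_pt]; norm_num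
  simp only [IsFEM, baseTri, average_clm_apply h0, average_clm_apply h1, average_clm_apply h2]
  constructor
  · rintro ⟨hq, v0, v2, v1, w0, w2, w1⟩
    exact ⟨hq, v0, by rw [e1]; exact v1, by rw [e2]; exact v2, w0, by rw [e1]; exact w1,
      by rw [e2, e3]; exact w2⟩
  · rintro ⟨hq, v0, v1, v2, w0, w1, w2⟩
    rw [e1] at v1 w1
    rw [e2] at v2 w2
    rw [e3] at w2
    exact ⟨hq, v0, v2, v1, w0, w2, w1⟩

/-- Here the order is `left`, `top`, `diag`, the opposite orientation to that of the lower triangle.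
-/
theorem isFEM_upper_iff {f : Plane → Plane} {Df : Plane → Plane →L[ℝ] Plane} {r a b : ℝ}
    (h0 : IntegrableOn Df (ball (pt a b) (r / 10)) volume)
    (h1 : IntegrableOn Df (ball (pt (a + r) b) (r / 10)) volume)
    (h2 : IntegrableOn Df (ball (pt (a + r) (b - r)) (r / 10)) volume) (A : Plane → Plane) :
    IsFEM f Df r (upperTri r a b) A ↔ IsHermite (fun s => ⨍ z in ball s (r / 10), f z)
      (fun s => ⨍ z in ball s (r / 10), Df z) r (pt a b) (pt 1 0) (pt 0 (-1)) A := by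
  have e1 : pt a b + r • pt 1 0 = pt (a + r) b := by rw [smul_pt, pt_add]; norm_num
  have e2 : pt a b + r • (pt 1 0 + pt 0 (-1)) = pt (a + r) (b - r) := by
    rw [pt_add, smul_pt, pt_add]; norm_num [sub_eq_add_neg]
  have e3 : -(pt 1 0 + pt 0 (-1)) = pt (-1) 1 := by rw [pt_add, neg_pt]; norm_num
  simp only [IsFEM, upperTri, average_clm_apply h0, average_clm_apply h1, average_clm_apply h2]
  constructor
  · rintro ⟨hq, v0, v1, v2, w0, w1, w2⟩
    exact ⟨hq, v0, by rw [e1]; exact v1, by rw [e2]; exact v2, w0, by rw [e1]; exact w1,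
      by rw [e2, e3]; exact w2⟩
  · rintro ⟨hq, v0, v1, v2, w0, w1, w2⟩
    rw [e1] at v1 w1
    rw [e2] at v2 w2
    rw [e3] at w2
    exact ⟨hq, v0, v1, v2, w0, w1, w2⟩

end Interpolation

/-! ### Disc averages of affine maps and the ratio of areas -/

section Averages

/-- The point reflection `z ↦ 2 s - z` preserves the disc and the measure and changes the sign of
the integrand. -/
theorem setIntegral_ball_clm_sub (L : Plane →L[ℝ] Plane) (s : Plane) (ρ : ℝ) :
    ∫ z in ball s ρ, L (z - s) = 0 := by
  rw [← integral_indicator measurableSet_ball]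
  set g : Plane → Plane := (ball s ρ).indicator fun z => L (z - s)
  have hg : ∀ z, g (s + s - z) = -g z := fun z => by
    have hz : s + s - z ∈ ball s ρ ↔ z ∈ ball s ρ := by
      rw [mem_ball, mem_ball, dist_eq_norm, dist_comm, dist_eq_norm]
      congr! 2
      abel
    by_cases h : z ∈ ball s ρ
    · simp only [g, Set.indicator_of_mem h, Set.indicator_of_mem (hz.2 h), ← map_neg]
      congr 1
      abel
    · simp only [g, Set.indicator_of_notMem h, Set.indicator_of_notMem (mt hz.1 h), neg_zero]
  have h := integral_sub_left_eq_self g volume (s + s)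
  simp_rw [hg, integral_neg] at h
  have h2 : (2 : ℝ) • ∫ z, g z = 0 := by
    rw [two_smul]
    nth_rewrite 1 [← h]
    exact neg_add_cancel _
  exact (smul_eq_zero.1 h2).resolve_left two_ne_zero

/-- The mean of an affine map over a disc is its value at the centre, so averaging preserves the
distance bound to it. -/
theorem norm_average_ball_sub_affine_le {f : Plane → Plane} {s c : Plane} {L : Plane →L[ℝ] Plane}
    {ρ k : ℝ} (hρ : 0 < ρ) (hf : IntegrableOn f (ball s ρ) volume)
    (h : ∀ z ∈ ball s ρ, ‖f z - c - L z‖ ≤ k) :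
    ‖(⨍ z in ball s ρ, f z) - (c + L s)‖ ≤ k := by
  have hb : 0 < (volume : Measure Plane).real (ball s ρ) := by
    rw [measureReal_ball_fin_two _ hρ.le]; positivity
  have hLi : IntegrableOn (fun z => L (z - s)) (ball s ρ) volume :=
    ((by fun_prop : Continuous fun z => L (z - s)).locallyIntegrable.integrableOn_isCompact
      (isCompact_closedBall s ρ)).mono_set ball_subset_closedBall
  have hci : IntegrableOn (fun _ : Plane => c + L s) (ball s ρ) volume :=
    integrableOn_const measure_ball_lt_top.ne
  have e : (∫ z in ball s ρ, (f z - c - L z)) =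
      (volume : Measure Plane).real (ball s ρ) • ((⨍ z in ball s ρ, f z) - (c + L s)) := by
    have h1 : ∀ z, f z - c - L z = f z - (c + L s) - L (z - s) := fun z => by
      rw [map_sub]; abel
    simp_rw [h1]
    rw [integral_sub (f := fun z => f z - (c + L s)) (hf.sub hci) hLi, setIntegral_ball_clm_sub, sub_zero, integral_sub hf hci,
      setIntegral_const, setAverage_eq, smul_sub, smul_smul, mul_inv_cancel₀ hb.ne', one_smul]
  have h2 := norm_setIntegral_le_of_norm_le_const (μ := volume) measure_ball_lt_top h
  rw [e, norm_smul, Real.norm_of_nonneg hb.le, mul_comm] at h2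
  exact le_of_mul_le_mul_right h2 hb

/-- The square lies in the disc of radius `6 * r`, whose area is `60 ^ 2` times that of the disc of
radius `r / 10`. -/
theorem measureReal_sq_le {r : ℝ} (hr : 0 < r) :
    volume (sq 0 (3 * r)) ≠ ⊤ ∧ (volume : Measure Plane).real (sq 0 (3 * r)) ≤
      3600 * (volume : Measure Plane).real (ball 0 (r / 10)) := by
  have h : sq 0 (3 * r) ⊆ ball 0 (6 * r) := fun z hz => by
    rw [mem_ball_zero_iff]; linarith [norm_lt_of_mem_sq hz]
  refine ⟨((measure_mono h).trans_lt measure_ball_lt_top).ne,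
    (measureReal_mono h measure_ball_lt_top.ne).trans_eq ?_⟩
  rw [measureReal_ball_fin_two _ (by positivity), measureReal_ball_fin_two _ (by positivity)]
  ring

end Averages

/-! ### Pairs of adjacent triangles -/

section Pairs

theorem convex_strips (σ τ : Plane →L[ℝ] ℝ) (r : ℝ) :
    Convex ℝ {z : Plane | (0 ≤ σ z ∧ σ z ≤ r) ∧ 0 ≤ τ z ∧ τ z ≤ r} :=
  ((convex_Icc 0 r).linear_preimage σ.toLinearMap).inter
    ((convex_Icc 0 r).linear_preimage τ.toLinearMap)

theorem IsQuadraticMap.eq_of_edge {A B : Plane → Plane} (hA : IsQuadraticMap A)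
    (hB : IsQuadraticMap B) {q v : Plane} {r : ℝ} (hr : r ≠ 0) (h0 : A q = B q)
    (h1 : A (q + r • v) = B (q + r • v)) (h2 : fderiv ℝ A q v = fderiv ℝ B q v) (t : ℝ) :
    A (q + t • v) = B (q + t • v) :=
  sub_eq_zero.1 ((hA.sub hB).eq_zero_of_edge hr (sub_eq_zero.2 h0) (sub_eq_zero.2 h1)
    (by rw [hA.fderiv_sub hB, sub_apply, h2, sub_self]) t)

/-- Every triangle adjacent to `baseTri r` has its right angle at the upper right, its union with
`baseTri r` is convex, and interpolants on the two triangles agree on the common side. -/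
theorem IsAdjacentTri.exists_upperTri {r : ℝ} (hr : 0 < r) {T : Tri} (hT : IsAdjacentTri r T) :
    ∃ a b : ℝ, T = upperTri r a b ∧ (|a| ≤ r ∧ |b| ≤ r ∧ |a + r| ≤ r ∧ |b - r| ≤ r) ∧
      Convex ℝ ((baseTri r).carrier ∪ (upperTri r a b).carrier) ∧
      ∀ f Df A B, IsFEM f Df r (baseTri r) A → IsFEM f Df r (upperTri r a b) B →
        ∀ z ∈ (baseTri r).carrier ∩ (upperTri r a b).carrier, A z = B z := by
  rcases hT with rfl | rfl | rfl
  · have hT : (⟨pt 0 r, pt r r, pt r 0⟩ : Tri) = upperTri r 0 r := by simp [upperTri]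
    refine ⟨0, r, hT, by simp [abs_of_pos hr, hr.le], ?_, ?_⟩
    -- The union is a parallelogram, the intersection of two strips; the common side cuts it along a
    -- diagonal.
    · convert convex_strips xCoord yCoord r using 1
      ext z
      simp only [Set.mem_union, mem_lower_iff hr, mem_upper_iff hr, Set.mem_ofPred_eq,
        xCoord_apply, yCoord_apply]
      constructor
      · rintro (⟨h1, h2, h3⟩ | ⟨h1, h2, h3⟩) <;> refine ⟨⟨?_, ?_⟩, ?_, ?_⟩ <;> linarith
      · rintro ⟨⟨h1, h2⟩, h3, h4⟩
        rcases le_total (z 0 + z 1) r with h | h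
        · exact Or.inl ⟨h1, h3, h⟩
        · exact Or.inr ⟨by linarith, h4, by linarith⟩
    · intro f Df A B hA hB z hz
      rw [← hT] at hB
      obtain ⟨hAq, -, hAt, hAd, -, -, hA'⟩ := hA
      obtain ⟨hBq, hBl, -, hBd, -, -, hB'⟩ := hB
      have e : pt r 0 + r • pt (-1) 1 = pt 0 r := by rw [smul_pt, pt_add]; norm_num
      -- On the diagonal side both interpolants take their slope at the same end, the lower right
      -- one, so all three data of that side coincide. The horizontal and vertical sides work alike,
      -- from their left and upper ends.
      have key := hAq.eq_of_edge hBq (q := pt r 0) (v := pt (-1) 1) hr.ne' (hAd.trans hBd.symm)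
        (by rw [e]; exact hAt.trans hBl.symm) (hA'.trans hB'.symm) (z 1)
      have hz' : z = pt r 0 + z 1 • pt (-1) 1 := by
        have h1 := (mem_lower_iff hr z).1 hz.1
        have h2 := (mem_upper_iff hr _ _ z).1 hz.2
        refine plane_ext ?_ ?_ <;> simp <;> linarith [h1.2.2, h2.2.2]
      rwa [← hz'] at key
  · have hT : (⟨pt 0 0, pt r 0, pt r (-r)⟩ : Tri) = upperTri r 0 0 := by simp [upperTri]
    refine ⟨0, 0, hT, by simp [abs_of_pos hr, hr.le], ?_, ?_⟩
    · convert convex_strips xCoord (xCoord + yCoord) r using 1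
      ext z
      simp only [Set.mem_union, mem_lower_iff hr, mem_upper_iff hr, Set.mem_ofPred_eq,
        xCoord_apply, yCoord_apply, add_apply]
      constructor
      · rintro (⟨h1, h2, h3⟩ | ⟨h1, h2, h3⟩) <;> refine ⟨⟨?_, ?_⟩, ?_, ?_⟩ <;> linarith
      · rintro ⟨⟨h1, h2⟩, h3, h4⟩
        rcases le_total 0 (z 1) with h | h
        · exact Or.inl ⟨h1, h, h4⟩
        · exact Or.inr ⟨by linarith, h, by linarith⟩
    · intro f Df A B hA hB z hz
      rw [← hT] at hB
      obtain ⟨hAq, hAl, -, hAd, hA', -, -⟩ := hA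
      obtain ⟨hBq, hBl, hBt, -, hB', -, -⟩ := hB
      have e : pt 0 0 + r • pt 1 0 = pt r 0 := by rw [smul_pt, pt_add]; norm_num
      have key := hAq.eq_of_edge hBq (q := pt 0 0) (v := pt 1 0) hr.ne' (hAl.trans hBl.symm)
        (by rw [e]; exact hAd.trans hBt.symm) (hA'.trans hB'.symm) (z 0)
      have hz' : z = pt 0 0 + z 0 • pt 1 0 := by
        have h1 := (mem_lower_iff hr z).1 hz.1
        have h2 := (mem_upper_iff hr _ _ z).1 hz.2
        refine plane_ext ?_ ?_ <;> simp <;> linarith [h1.2.1, h2.2.1]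
      rwa [← hz'] at key
  · have hT : (⟨pt (-r) r, pt 0 r, pt 0 0⟩ : Tri) = upperTri r (-r) r := by simp [upperTri]
    refine ⟨-r, r, hT, by simp [abs_of_pos hr, hr.le], ?_, ?_⟩
    · convert convex_strips yCoord (xCoord + yCoord) r using 1
      ext z
      simp only [Set.mem_union, mem_lower_iff hr, mem_upper_iff hr, Set.mem_ofPred_eq,
        xCoord_apply, yCoord_apply, add_apply]
      constructor
      · rintro (⟨h1, h2, h3⟩ | ⟨h1, h2, h3⟩) <;> refine ⟨⟨?_, ?_⟩, ?_, ?_⟩ <;> linarith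
      · rintro ⟨⟨h1, h2⟩, h3, h4⟩
        rcases le_total 0 (z 0) with h | h
        · exact Or.inl ⟨h, h1, h4⟩
        · exact Or.inr ⟨by linarith, h2, by linarith⟩
    · intro f Df A B hA hB z hz
      rw [← hT] at hB
      obtain ⟨hAq, hAl, hAt, -, -, hA', -⟩ := hA
      obtain ⟨hBq, -, hBt, hBd, -, hB', -⟩ := hB
      have e : pt 0 r + r • pt 0 (-1) = pt 0 0 := by rw [smul_pt, pt_add]; norm_num
      have key := hAq.eq_of_edge hBq (q := pt 0 r) (v := pt 0 (-1)) hr.ne' (hAt.trans hBt.symm)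
        (by rw [e]; exact hAl.trans hBd.symm) (hA'.trans hB'.symm) (r - z 1)
      have hz' : z = pt 0 r + (r - z 1) • pt 0 (-1) := by
        have h1 := (mem_lower_iff hr z).1 hz.1
        have h2 := (mem_upper_iff hr _ _ z).1 hz.2
        refine plane_ext ?_ ?_ <;> simp <;> linarith [h1.1, h2.1]
      rwa [← hz'] at key

/-- Two quadratic mappings which agree on the common part of two sets with convex union, and whose
derivatives are close to a fixed invertible linear mapping, glue to a homeomorphism. -/
theorem isHomeoOn_glue {S T : Set Plane} (hS : IsClosed S) (hT : IsClosed T) (hSc : Convex ℝ S)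
    (hTc : Convex ℝ T) (hST : Convex ℝ (S ∪ T)) {A B : Plane → Plane} (hA : IsQuadraticMap A)
    (hB : IsQuadraticMap B) (hAB : ∀ z ∈ S ∩ T, A z = B z) {L : Plane →L[ℝ] Plane} {δ : ℝ}
    (hδ : 0 < δ) (hδ1 : δ < 1) (hdet : δ < L.det) (hL : ‖L‖ < 1 / δ)
    (hAL : ∀ z ∈ S, ‖fderiv ℝ A z - L‖ ≤ δ ^ 2 / 16)
    (hBL : ∀ z ∈ T, ‖fderiv ℝ B z - L‖ ≤ δ ^ 2 / 16) :
    IsHomeoOn (glue S A B) (S ∪ T) ∧ (∀ z ∈ S, δ / 2 < (fderiv ℝ A z).det) ∧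
      ∀ z ∈ T, δ / 2 < (fderiv ℝ B z).det := by
  have hδ2 : 0 < δ ^ 2 := by positivity
  exact ⟨isHomeoOn_of_norm_sub_le (k := δ ^ 2 / 16) (m := δ ^ 2 / 4) (by positivity) (by linarith)
    (sq_div_four_mul_norm_le hδ hdet hL) fun x hx y hy => norm_glue_sub_le hS hT hST hAB
      (hA.norm_sub_le_of_fderiv hSc hAL) (hB.norm_sub_le_of_fderiv hTc hBL) hx hy,
    fun z hz => half_lt_det hδ hδ1 hdet hL (hAL z hz),
    fun z hz => half_lt_det hδ hδ1 hdet hL (hBL z hz)⟩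

end Pairs

theorem pt_mem_sq {r a b : ℝ} (hr : 0 < r) (ha : |a| ≤ r) (hb : |b| ≤ r) : pt a b ∈ sq 0 (2 * r) :=
  ⟨by simp; linarith, by simp; linarith⟩

theorem norm_sub_le_of_mem_lower {r : ℝ} (hr : 0 < r) {z : Plane}
    (hz : z ∈ (baseTri r).carrier) : ‖z - pt 0 0‖ ≤ 2 * r := by
  obtain ⟨h1, h2, h3⟩ := (mem_lower_iff hr z).1 hz
  refine (norm_le_abs_add_abs _).trans ?_
  simp [abs_of_nonneg h1, abs_of_nonneg h2]
  linarith

theorem norm_sub_le_of_mem_upper {r a b : ℝ} (hr : 0 < r) {z : Plane}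
    (hz : z ∈ (upperTri r a b).carrier) : ‖z - pt a b‖ ≤ 2 * r := by
  obtain ⟨h1, h2, h3⟩ := (mem_upper_iff hr a b z).1 hz
  refine (norm_le_abs_add_abs _).trans ?_
  simp only [PiLp.sub_apply, pt_zero, pt_one]
  rw [abs_of_nonneg (by linarith), abs_of_nonpos (by linarith)]
  linarith

theorem mem_sq_of_mem_lower {r : ℝ} (hr : 0 < r) {z : Plane} (hz : z ∈ (baseTri r).carrier) :
    z ∈ sq 0 (2 * r) := by
  obtain ⟨h1, h2, h3⟩ := (mem_lower_iff hr z).1 hz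
  constructor <;> simp [abs_of_nonneg h1, abs_of_nonneg h2] <;> linarith

end FEMQuad

/-! ### Assembly of the estimates -/

theorem theorem5p1 :
    ∃ C C₀ C₁ : ℝ, 0 < C ∧ 0 < C₀ ∧ 0 < C₁ ∧
      ∀ (r δ ε : ℝ) (f : FEMQuad.Plane → FEMQuad.Plane)
        (Df : FEMQuad.Plane → FEMQuad.Plane →L[ℝ] FEMQuad.Plane)
        (D2f : FEMQuad.Plane → FEMQuad.Plane →L[ℝ] FEMQuad.Plane →L[ℝ] FEMQuad.Plane),
        0 < r → 0 < δ → δ < 1 → 0 < ε →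
        FEMQuad.IsW21 f Df D2f (FEMQuad.sq 0 (3 * r)) →
        FEMQuad.IsHomeoOn f (FEMQuad.sq 0 (2 * r)) →
        δ < (Df 0).det →
        ‖Df 0‖ < 1 / δ →
        (∀ z ∈ FEMQuad.sq 0 (3 * r), z ≠ 0 → ‖f z - f 0 - Df 0 z‖ < ε * ‖z‖) →
        (⨍ z in FEMQuad.sq 0 (3 * r), ‖Df z - Df 0‖) < ε →
        (⨍ z in FEMQuad.sq 0 (3 * r), ‖D2f z - D2f 0‖) < ε →
        ∃ A₁ : FEMQuad.Plane → FEMQuad.Plane,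
          FEMQuad.IsFEM f Df r (FEMQuad.baseTri r) A₁ ∧
          (∀ B, FEMQuad.IsFEM f Df r (FEMQuad.baseTri r) B → B = A₁) ∧
          (∀ z, fderiv ℝ (fderiv ℝ A₁) z = fderiv ℝ (fderiv ℝ A₁) 0) ∧
          ‖fderiv ℝ (fderiv ℝ A₁) 0 - D2f 0‖ < C * ε ∧
          (∀ z ∈ (FEMQuad.baseTri r).carrier, ‖f z - A₁ z‖ < C₁ * r * ε) ∧
          ∀ T₂ : FEMQuad.Tri, FEMQuad.IsAdjacentTri r T₂ →
            ∃ A₂ : FEMQuad.Plane → FEMQuad.Plane,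
              FEMQuad.IsFEM f Df r T₂ A₂ ∧
              (∀ B, FEMQuad.IsFEM f Df r T₂ B → B = A₂) ∧
              (∀ z, fderiv ℝ (fderiv ℝ A₂) z = fderiv ℝ (fderiv ℝ A₂) 0) ∧
              ‖fderiv ℝ (fderiv ℝ A₂) 0 - D2f 0‖ < C * ε ∧
              (∀ z ∈ (FEMQuad.baseTri r).carrier ∩ T₂.carrier,
                ‖fderiv ℝ A₁ z - fderiv ℝ A₂ z‖ < C * ε * r) ∧
              (∀ z ∈ (FEMQuad.baseTri r).carrier ∩ T₂.carrier, A₁ z = A₂ z) ∧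
              (ε < C₀ * δ ^ 2 →
                FEMQuad.IsHomeoOn (FEMQuad.glue (FEMQuad.baseTri r).carrier A₁ A₂)
                  ((FEMQuad.baseTri r).carrier ∪ T₂.carrier) ∧
                (∀ z ∈ (FEMQuad.baseTri r).carrier, δ / 2 < (fderiv ℝ A₁ z).det) ∧
                (∀ z ∈ T₂.carrier, δ / 2 < (fderiv ℝ A₂ z).det)) := by
  open FEMQuad Metric in
  -- The largest constant required is `2 * 2404 * 3600`, from the two gradient comparisons, and it
  -- is below `10 ^ 8`. For the homeomorphism, `600 * 3600 / 10 ^ 8` must be at most `1 / 16`.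
  refine ⟨10 ^ 8, 1 / 10 ^ 8, 10 ^ 8, by norm_num, by norm_num, by norm_num, ?_⟩
  intro r δ ε f Df D2f hr hδ hδ1 hε hW _ hdet hnorm haff hDavg hD2avg
  obtain ⟨hfi, hDi, hD2i, hw1, hw2⟩ := hW
  have hρ : 0 < r / 10 := by positivity
  have hΩ := (isOpen_sq 0 (3 * r)).measurableSet
  have hUo := isOpen_sq 0 (2 * r)
  have hUc := convex_sq 0 (2 * r)
  have hεr : 0 < ε * r := mul_pos hε hr
  have hUΩ : ∀ s ∈ sq 0 (2 * r), closedBall s (r / 10) ⊆ sq 0 (3 * r) := fun s hs =>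
    closedBall_subset_sq hs (by linarith)
  have hUb : ∀ s ∈ sq 0 (2 * r), ball s (r / 10) ⊆ sq 0 (3 * r) := fun s hs =>
    ball_subset_closedBall.trans (hUΩ s hs)
  obtain ⟨hvol, hvol'⟩ := measureReal_sq_le hr
  -- Points of the square have norm below `6 * r`. The origin is treated apart because the strict
  -- hypothesis excludes it.
  have haff' : ∀ z ∈ sq 0 (3 * r), ‖f z - f 0 - Df 0 z‖ ≤ 6 * ε * r := fun z hz => by
    by_cases h0 : z = 0
    · simpa [h0] using (by positivity : 0 ≤ 6 * ε * r)
    · have h1 := mul_le_mul_of_nonneg_left (norm_lt_of_mem_sq hz).le hε.le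
      linarith [haff z hz h0]
  have hF : ∀ s ∈ sq 0 (2 * r), HasFDerivAt (fun s => ⨍ t in ball s (r / 10), f t)
      (⨍ t in ball s (r / 10), Df t) s := fun s hs =>
    hw1.hasFDerivAt_average_ball hΩ hfi hDi hρ hUo hUΩ hs
  have hDF : ∀ s ∈ sq 0 (2 * r), HasFDerivAt (fun s => ⨍ t in ball s (r / 10), Df t)
      (⨍ t in ball s (r / 10), D2f t) s := fun s hs =>
    hw2.hasFDerivAt_average_ball hΩ hDi hD2i hρ hUo hUΩ hs
  have h2 : ∀ s ∈ sq 0 (2 * r), ‖(⨍ t in ball s (r / 10), D2f t) - D2f 0‖ ≤ 3600 * ε :=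
    fun s hs => (norm_average_ball_sub_le hD2i hρ hvol hvol' (hUb s hs) _).trans (by linarith)
  have h1 : ∀ s ∈ sq 0 (2 * r), ‖(⨍ t in ball s (r / 10), Df t) - Df 0‖ ≤ 3600 * ε :=
    fun s hs => (norm_average_ball_sub_le hDi hρ hvol hvol' (hUb s hs) _).trans (by linarith)
  have h0 : ∀ s ∈ sq 0 (2 * r), ‖(⨍ t in ball s (r / 10), f t) - (f 0 + Df 0 s)‖ ≤
      3600 * ε * r := fun s hs =>
    (norm_average_ball_sub_affine_le hρ (hfi.mono_set (hUb s hs))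
      fun z hz => haff' z (hUb s hs hz)).trans (by linarith)
  have hint : ∀ s ∈ sq 0 (2 * r), IntegrableOn Df (ball s (r / 10)) volume := fun s hs =>
    hDi.mono_set (hUb s hs)
  have h00 : |(0 : ℝ)| ≤ r := by simpa using hr.le
  have hrr : |r| ≤ r := (abs_of_pos hr).le
  have p0 := pt_mem_sq hr h00 h00
  have p1 := pt_mem_sq hr hrr h00
  have p2 := pt_mem_sq hr h00 hrr
  have fem₁ := fun A => isFEM_lower_iff (f := f) (hint _ p0) (hint _ p1) (hint _ p2) A
  obtain ⟨A₁, hA₁⟩ := IsHermite.exists isFrame_lower (fun s => ⨍ t in ball s (r / 10), f t)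
    (fun s => ⨍ t in ball s (r / 10), Df t) hr (pt 0 0)
  have e1 : pt 0 0 + r • pt 1 0 = pt r 0 := by rw [smul_pt, pt_add]; norm_num
  have e2 : pt 0 0 + r • (pt 1 0 + pt (-1) 1) = pt 0 r := by
    rw [pt_add, smul_pt, pt_add]; norm_num
  obtain ⟨tay₁, tay₁'⟩ := hA₁.approx_taylor isFrame_lower hUo hUc hF hDF hr h2 p0
    (by rwa [e1]) (by rwa [e2])
  have aff₁ : ∀ z ∈ (baseTri r).carrier, _ := fun z hz =>
    hA₁.approx_affine isFrame_lower hr h1 h0 p0 (by rwa [e1]) (by rwa [e2])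
      (norm_sub_le_of_mem_lower hr hz)
  refine ⟨A₁, (fem₁ A₁).2 hA₁, fun B hB => hA₁.unique isFrame_lower hr ((fem₁ B).1 hB),
    hA₁.quad.fderiv_fderiv_eq, by linarith, fun z hz => ?_, fun T₂ hT₂ => ?_⟩
  -- Both `f` and `A₁` are compared with the affine map `f 0 + Df 0 z`.
  · have g1 := (aff₁ z hz).2
    have g2 := haff' z (hUb z (mem_sq_of_mem_lower hr hz) (mem_ball_self hρ))
    rw [norm_sub_rev] at g1
    rw [sub_sub] at g2
    linarith [norm_sub_le_norm_sub_add_norm_sub (f z) (f 0 + Df 0 z) (A₁ z)]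
  · obtain ⟨a, b, rfl, ⟨ha, hb, har, hbr⟩, hconv, hagree⟩ := hT₂.exists_upperTri hr
    have q0 := pt_mem_sq hr ha hb
    have q1 := pt_mem_sq hr har hb
    have q2 := pt_mem_sq hr har hbr
    have fem₂ := fun A => isFEM_upper_iff (f := f) (hint _ q0) (hint _ q1) (hint _ q2) A
    obtain ⟨A₂, hA₂⟩ := IsHermite.exists isFrame_upper (fun s => ⨍ t in ball s (r / 10), f t)
      (fun s => ⨍ t in ball s (r / 10), Df t) hr (pt a b)
    have e3 : pt a b + r • pt 1 0 = pt (a + r) b := by rw [smul_pt, pt_add]; norm_num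
    have e4 : pt a b + r • (pt 1 0 + pt 0 (-1)) = pt (a + r) (b - r) := by
      rw [pt_add, smul_pt, pt_add]; norm_num [sub_eq_add_neg]
    obtain ⟨tay₂, tay₂'⟩ := hA₂.approx_taylor isFrame_upper hUo hUc hF hDF hr h2 q0
      (by rwa [e3]) (by rwa [e4])
    have aff₂ : ∀ z ∈ (upperTri r a b).carrier, _ := fun z hz =>
      hA₂.approx_affine isFrame_upper hr h1 h0 q0 (by rwa [e3]) (by rwa [e4])
        (norm_sub_le_of_mem_upper hr hz)
    have hag := hagree f Df A₁ A₂ ((fem₁ A₁).2 hA₁) ((fem₂ A₂).2 hA₂)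
    refine ⟨A₂, (fem₂ A₂).2 hA₂, fun B hB => hA₂.unique isFrame_upper hr ((fem₂ B).1 hB),
      hA₂.quad.fderiv_fderiv_eq, by linarith, fun z hz => ?_, hag, fun hε0 => ?_⟩
    -- Both gradients are compared with the same averaged derivative at `z`. The Taylor comparison
    -- is needed here, as the affine one would lose the factor `r`.
    · have hzU := mem_sq_of_mem_lower hr hz.1
      have g1 := tay₁' z hzU (norm_sub_le_of_mem_lower hr hz.1)
      have g2 := tay₂' z hzU (norm_sub_le_of_mem_upper hr hz.2)
      rw [norm_sub_rev] at g2
      linarith [norm_sub_le_norm_sub_add_norm_sub (fderiv ℝ A₁ z)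
        (⨍ t in ball z (r / 10), Df t) (fderiv ℝ A₂ z)]
    · exact isHomeoOn_glue (isClosed_carrier _) (isClosed_carrier _) (convex_carrier _)
        (convex_carrier _) hconv hA₁.quad hA₂.quad hag hδ hδ1 hdet hnorm
        (fun z hz => (aff₁ z hz).1.trans (by linarith))
        (fun z hz => (aff₂ z hz).1.trans (by linarith))
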